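/- Let $\gamma:[a,b]\to\mathbb{R}^2$ ($a<b$) be a parametrized simple polygonal arc, let $0<\theta<\pi$, and let $X_1,\dots,X_n$ be the corner points (extreme points) of the convex hull of $\gamma$, numbered in the order in which they appear along $\gamma$. An angle of size $\theta$ is the closed convex sector bounded by two closed rays that issue from a common vertex at angle $\theta$; it is called alternating if it contains $\gamma$ and there are parameters $t_1<t_2<t_3$ such that $\gamma(t_1)$ and $\gamma(t_3)$ lie on one of its rays and $\gamma(t_2)$ lies on the other. (The lines of the two rays are then a pair of support lines of $\gamma$.) Then $\gamma$ is contained in two different angles $S,S'$ of size $\theta$ such that 1) $X_1$ is the vertex of $S$, or $S$ is alternating; and 2) $X_n$ is the vertex of $S'$, or $S'$ is alternating. In total there are at most two alternating angles of size $\theta$. When there are two, they can be named $S_U$ and $S_V$, with vertices $U$ and $V$, so that they interlace in one of the following ways. (i) $S_U$ and $S_V$ share the line of one of their rays, and there are parameters $p<q\le r<s$ such that $\gamma(p),\gamma(s)$ lie on the rays of both angles on that line, $U,\gamma(p),\gamma(s),V$ come in this order (possibly with $U=\gamma(p)$ or $\gamma(s)=V$) on it, $\gamma(q)$ lies on the other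 ray of $S_U$, and $\gamma(r)$ lies on the other ray of $S_V$. (ii) The four lines are different, and there are parameters $p_1<p_2<p_3$ and $q_1<q_2<q_3$ such that $\gamma(p_1),\gamma(p_3)$ lie on one ray $u$ of $S_U$ and $\gamma(p_2)$ on its other ray; $\gamma(q_1),\gamma(q_3)$ lie on one ray $v$ of $S_V$ and $\gamma(q_2)$ on its other ray; $U,\gamma(p_1),\gamma(p_3)$ come in this order on $u$ (possibly $U=\gamma(p_1)$), and $\gamma(q_1),\gamma(q_3),V$ come in this order on $v$ (possibly $V=\gamma(q_3)$). Call the ray of an angle from which its other ray is obtained by a counterclockwise rotation by $\theta$ its first ray, and the other one its second ray. Then one of the following holds: - $u,v$ are both first or both second rays, and $p_2\le q_1<p_3\le q_2$; - one of $u,v$ is a first ray and the other a second ray, and $p_3\le q_1$; - $u,v$ are both first or both second rays, and $p_3<q_1$. -/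

import Mathlib

open Set

/-- `γ`, restricted to `[a, b]`, is a parametrized simple polygonal arc in the Euclidean plane
`ℂ`: it is continuous and injective on `[a, b]`, and `[a, b]` splits into finitely many
consecutive intervals each of which is carried onto a straight segment. -/
structure IsSimplePolygonalArc (γ : ℝ → ℂ) (a b : ℝ) : Prop where
  lt : a < b
  continuousOn : ContinuousOn γ (Icc a b)
  injOn : InjOn γ (Icc a b)
  polygonal : ∃ (k : ℕ) (s : ℕ → ℝ), s 0 = a ∧ s k = b ∧
    ∀ i < k, s i < s (i + 1) ∧
      γ '' Icc (s i) (s (i + 1)) = segment ℝ (γ (s i)) (γ (s (i + 1)))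

/-- `X 0, …, X n` are the corner points (the extreme points) of the convex hull of the arc,
each listed once, in the order in which the arc passes through them. -/
def IsCornerList (γ : ℝ → ℂ) (a b : ℝ) {n : ℕ} (X : Fin (n + 1) → ℂ) : Prop :=
  range X = (convexHull ℝ (γ '' Icc a b)).extremePoints ℝ ∧
    ∃ t : Fin (n + 1) → ℝ, StrictMono t ∧ ∀ i, t i ∈ Icc a b ∧ γ (t i) = X i

/-- An angle of size `θ` in the plane: it is given by its vertex and the unit direction of its
first ray; its second ray is obtained from the first by the counterclockwise rotation by `θ`
about the vertex. For `0 < θ < π` each angle of size `θ` is represented exactly once. -/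
@[ext]
structure PlaneAngle (θ : ℝ) where
  vertex : ℂ
  dir : ℂ
  norm_dir : ‖dir‖ = 1

namespace PlaneAngle

variable {θ : ℝ}

/-- The unit directions of the two rays: `false` is the first ray, `true` the second. -/
noncomputable def rayDir (A : PlaneAngle θ) : Bool → ℂ
  | false => A.dir
  | true => A.dir * Complex.exp (θ * Complex.I)

/-- The two rays of the angle (closed: the vertex lies on both). -/
def ray (A : PlaneAngle θ) (i : Bool) : Set ℂ :=
  {z | ∃ r : ℝ, 0 ≤ r ∧ z = A.vertex + r * A.rayDir i}

/-- The lines that carry the two rays. -/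
def line (A : PlaneAngle θ) (i : Bool) : Set ℂ :=
  {z | ∃ r : ℝ, z = A.vertex + r * A.rayDir i}

/-- The closed convex region bounded by the two rays (for `0 < θ < π`). -/
def region (A : PlaneAngle θ) : Set ℂ :=
  {z | ∃ r s : ℝ, 0 ≤ r ∧ 0 ≤ s ∧ z = A.vertex + r * A.rayDir false + s * A.rayDir true}

/-- The arc lies within the angle. -/
def Contains (A : PlaneAngle θ) (γ : ℝ → ℂ) (a b : ℝ) : Prop :=
  γ '' Icc a b ⊆ A.region

/-- The arc touches the rays of the angle at three points with parameters `t₁ < t₂ < t₃`, the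
outer two on the ray `i`, the middle one on the other ray. -/
def AlternatesAt (A : PlaneAngle θ) (γ : ℝ → ℂ) (a b : ℝ) (i : Bool) (t₁ t₂ t₃ : ℝ) : Prop :=
  a ≤ t₁ ∧ t₁ < t₂ ∧ t₂ < t₃ ∧ t₃ ≤ b ∧
    γ t₁ ∈ A.ray i ∧ γ t₂ ∈ A.ray (!i) ∧ γ t₃ ∈ A.ray i

/-- The arc lies within the angle and touches its rays at three alternating points; the lines of
the angle are then a pair of support lines of the arc, with three alternating points. -/
def IsAlternating (A : PlaneAngle θ) (γ : ℝ → ℂ) (a b : ℝ) : Prop :=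
  A.Contains γ a b ∧ ∃ (i : Bool) (t₁ t₂ t₃ : ℝ), A.AlternatesAt γ a b i t₁ t₂ t₃

/-- The two angles share the line of one of their rays. On that line there are two points
`γ p`, `γ s` of the arc, and the vertices and these two points come in the order
`A.vertex, γ p, γ s, B.vertex`. The other ray of `A` is touched at `γ q` and the other ray of
`B` at `γ r`, with `p < q ≤ r < s`. -/
def InterlaceCommonLine (A B : PlaneAngle θ) (γ : ℝ → ℂ) (a b : ℝ) : Prop :=
  ∃ (i : Bool) (p q r s : ℝ), A.line i = B.line (!i) ∧ q ≤ r ∧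
    A.AlternatesAt γ a b i p q s ∧ B.AlternatesAt γ a b (!i) p r s ∧
    Wbtw ℝ A.vertex (γ p) (γ s) ∧ Wbtw ℝ (γ p) (γ s) B.vertex

/-- The four lines are different, and there are alternating triples `p₁ < p₂ < p₃` for `A` and
`q₁ < q₂ < q₃` for `B` such that `γ p₁` is not further from the vertex of `A` than `γ p₃`, and
`γ q₃` is not further from the vertex of `B` than `γ q₁`. Seen along the arc the vertex of `A` is
behind and the vertex of `B` ahead, so the ray `i` of `A` and the ray `!i` of `B` bound the arc
on the same side, and the ray `i` of `A` and the ray `i` of `B` on opposite sides. The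
three configurations are:
* doubly touched rays on opposite sides and overlapping triples, `p₂ ≤ q₁ < p₃ ≤ q₂`;
* doubly touched rays on the same side, and the triple of `A` comes before that of `B`
  (possibly with `p₃ = q₁`);
* doubly touched rays on opposite sides, and the triple of `A` comes strictly before that
  of `B`. -/
def InterlaceFourLines (A B : PlaneAngle θ) (γ : ℝ → ℂ) (a b : ℝ) : Prop :=
  (∀ i j : Bool, A.line i ≠ B.line j) ∧
  ∃ (i j : Bool) (p₁ p₂ p₃ q₁ q₂ q₃ : ℝ),
    A.AlternatesAt γ a b i p₁ p₂ p₃ ∧ B.AlternatesAt γ a b j q₁ q₂ q₃ ∧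
    Wbtw ℝ A.vertex (γ p₁) (γ p₃) ∧ Wbtw ℝ (γ q₁) (γ q₃) B.vertex ∧
    ((j = i ∧ p₂ ≤ q₁ ∧ q₁ < p₃ ∧ p₃ ≤ q₂) ∨
      (j = !i ∧ p₃ ≤ q₁) ∨
      (j = i ∧ p₃ < q₁))

/-- The pairs of lines of `A` and `B` interlace along the arc, `A` coming first. -/
def Interlace (A B : PlaneAngle θ) (γ : ℝ → ℂ) (a b : ℝ) : Prop :=
  A.InterlaceCommonLine B γ a b ∨ A.InterlaceFourLines B γ a b

end PlaneAngle

/-! The topological core replaces the Jordan curve theorem. If two parts of the arc are disjoint,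
then `g σ - g τ` does not vanish on the parameter rectangle, has a continuous logarithm there, and
its argument changes by zero around the boundary. When the four end points lie on support lines, the
change along each side is a difference of principal arguments (`arg_sum_eq_zero`). Four contact
points whose four angles all have the same weak sign, one of them strictly, therefore cannot belong
to disjoint parts.

An alternating triple `p₁ < p₂ < p₃` is forward or backward (`IsForwardAt`, `IsBackwardAt`), and
reversing the arc exchanges the two. For a forward triple of `A`, a contact with a support line
whose inward normal has two positive coefficients in the coordinates of `A` comes no later than
`p₂`; if a coefficient is negative, it comes no earlier (`le_of_isMin_near`, `le_of_isMin_far`).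

Let `φ` be the rotation from the first ray of `A` to that of `B`. Up to a positive factor, the
normals of the first and second ray of `B` have coefficients `(-sin φ, sin (θ - φ))` and `(sin (θ +
φ), sin φ)` in the coordinates of `A`. By symmetry let `0 ≤ φ ≤ π`. If `φ = 0` the angles coincide;
if `0 < φ < π - θ`, `p₂` separates the contacts with the two rays of `B`, so `B` does not alternate;
if `φ = π - θ` a line is shared; beyond that all four lines differ and both normals are of the
second kind. In the last two cases two forward angles are impossible, and a forward and a backward
one interlace. Hence there is at most one alternating angle of each kind.

For existence, an angle touching the arc with both rays is rotated until the order of its two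
contacts switches (`exists_facesVertex`). The first corner then faces its vertex. The same
construction on the reversed arc gives an angle faced by the last corner, and no angle faced by both
fits the statement's alternatives (`not_facesVertex`). -/

/-! ### Continuous arguments of differences of curve points -/

/-- In the closed right half plane without 0 the principal logarithm is continuous. Thus `log (F /
n)` and `L` differ by a constant, by uniqueness of lifts through `exp`. -/
theorem im_sub_of_exp_eq {S : Set ℝ} (hS : IsPreconnected S) {L F : ℝ → ℂ} {n : ℂ} (hn : n ≠ 0)
    (hL : ContinuousOn L S) (hF : ContinuousOn F S) (hexp : ∀ u ∈ S, Complex.exp (L u) = F u)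
    (hre : ∀ u ∈ S, 0 ≤ (F u / n).re) {u v : ℝ} (hu : u ∈ S) (hv : v ∈ S) :
    (L v).im - (L u).im = (F v / n).arg - (F u / n).arg := by
  have hF0 : ∀ u ∈ S, F u / n ≠ 0 := fun u hu =>
    div_ne_zero (by rw [← hexp u hu]; exact Complex.exp_ne_zero _) hn
  have hslit : ∀ u ∈ S, F u / n ∈ Complex.slitPlane := by
    intro u hu
    rw [Complex.mem_slitPlane_iff]
    rcases (hre u hu).lt_or_eq with h | h
    · exact Or.inl h
    · exact Or.inr fun h' => hF0 u hu (Complex.ext h.symm h')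
  have hc : ContinuousOn (fun w => Complex.log (F w / n) + (L u - Complex.log (F u / n))) S :=
    ((hF.div_const n).clog hslit).add continuousOn_const
  have key := Complex.isCoveringMap_exp.eqOn_of_comp_eqOn hS hL hc (fun w hw => by
    apply Subtype.ext
    simp only [Function.comp]
    rw [Complex.exp_add, Complex.exp_sub, Complex.exp_log (hF0 w hw), Complex.exp_log (hF0 u hu),
      hexp u hu, hexp w hw]
    have h1 := hF0 u hu
    have h2 : F u ≠ 0 := fun h => h1 (by simp [h])
    field_simp) hu (by simp) hv
  have := congrArg Complex.im key
  simp only [Complex.add_im, Complex.sub_im, Complex.log_im] at this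
  linarith

/-- Two disjoint arcs of a curve, from `g p` to `g r` and from `g q` to `g s`, whose end points
have supporting half planes with inward normals `np`, `nr`, `nq`, `ns`: the oriented angles of the
closed polygon `g p, g q, g r, g s` sum up to zero. -/
theorem arg_sum_eq_zero {g : ℝ → ℂ} {p q r s : ℝ} {np nq nr ns : ℂ}
    (hI : ContinuousOn g (uIcc p r)) (hJ : ContinuousOn g (uIcc q s))
    (hne : ∀ σ ∈ uIcc p r, ∀ τ ∈ uIcc q s, g σ ≠ g τ)
    (hnp : np ≠ 0) (hnq : nq ≠ 0) (hnr : nr ≠ 0) (hns : ns ≠ 0)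
    (hp : ∀ τ ∈ uIcc q s, 0 ≤ ((g τ - g p) / np).re)
    (hq : ∀ σ ∈ uIcc p r, 0 ≤ ((g σ - g q) / nq).re)
    (hr : ∀ τ ∈ uIcc q s, 0 ≤ ((g τ - g r) / nr).re)
    (hs : ∀ σ ∈ uIcc p r, 0 ≤ ((g σ - g s) / ns).re) :
    (((g q - g p) / np).arg - ((g s - g p) / np).arg) +
    (((g r - g q) / nq).arg - ((g p - g q) / nq).arg) +
    (((g s - g r) / nr).arg - ((g q - g r) / nr).arg) +
    (((g p - g s) / ns).arg - ((g r - g s) / ns).arg) = 0 := by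
  -- `c u v` is the retraction of the line onto `uIcc u v`. It extends the difference map from the
  -- rectangle to the whole plane, which is simply connected, so that it lifts through `exp`.
  set c : ℝ → ℝ → ℝ → ℝ := fun u v w => max (min u v) (min w (max u v)) with hc
  have hcmem : ∀ u v w, c u v w ∈ uIcc u v := fun u v w => by
    simp only [hc, uIcc, mem_Icc]
    exact ⟨le_max_left _ _, max_le (min_le_max) (min_le_right _ _)⟩
  have hceq : ∀ u v, ∀ w ∈ uIcc u v, c u v w = w := fun u v w hw => by
    simp only [uIcc, mem_Icc] at hw
    simp only [hc]
    rw [min_eq_left hw.2, max_eq_right hw.1]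
  have hccont : ∀ u v, Continuous (c u v) := fun u v => by fun_prop
  have h1 : Continuous fun w => g (c p r w) := hI.comp_continuous (hccont p r) (hcmem p r)
  have h2 : Continuous fun w => g (c q s w) := hJ.comp_continuous (hccont q s) (hcmem q s)
  let F : C(ℝ × ℝ, ℂ) := ⟨fun z => g (c p r z.1) - g (c q s z.2),
    (h1.comp continuous_fst).sub (h2.comp continuous_snd)⟩
  have hF0 : ∀ z, F z ≠ 0 := fun z => sub_ne_zero.2 (hne _ (hcmem _ _ _) _ (hcmem _ _ _))
  obtain ⟨L, ⟨-, hL⟩, -⟩ := Complex.isCoveringMapOn_exp.existsUnique_continuousMap_lifts F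
    (a₀ := ((0 : ℝ), (0 : ℝ))) (e₀ := Complex.log (F (0, 0))) (Complex.exp_log (hF0 _))
    (fun z => hF0 z)
  have hexp : ∀ σ ∈ uIcc p r, ∀ τ ∈ uIcc q s, Complex.exp (L (σ, τ)) = g σ - g τ := by
    intro σ hσ τ hτ
    have := congrFun hL (σ, τ)
    simp only [Function.comp] at this
    rw [this]
    change g (c p r σ) - g (c q s τ) = _
    rw [hceq _ _ _ hσ, hceq _ _ _ hτ]
  have hLc := L.continuous
  have e1 := im_sub_of_exp_eq (S := uIcc p r) isPreconnected_uIcc (L := fun σ => L (σ, q))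
    (F := fun σ => g σ - g q) hnq (by fun_prop) (hI.sub continuousOn_const)
    (fun σ hσ => hexp σ hσ q left_mem_uIcc) hq left_mem_uIcc right_mem_uIcc
  have e3 := im_sub_of_exp_eq (S := uIcc p r) isPreconnected_uIcc (L := fun σ => L (σ, s))
    (F := fun σ => g σ - g s) hns (by fun_prop) (hI.sub continuousOn_const)
    (fun σ hσ => hexp σ hσ s right_mem_uIcc) hs left_mem_uIcc right_mem_uIcc
  -- On the two sides where `τ` varies, the half plane condition concerns `g τ - g r`, the negative
  -- of the lifted function; hence the normals `-nr` and `-np`.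
  have hneg : ∀ z w n : ℂ, (z - w) / (-n) = (w - z) / n := fun z w n => by
    rw [div_neg, ← neg_div, neg_sub]
  have e2 := im_sub_of_exp_eq (S := uIcc q s) isPreconnected_uIcc (L := fun τ => L (r, τ))
    (F := fun τ => g r - g τ) (neg_ne_zero.2 hnr) (by fun_prop) (continuousOn_const.sub hJ)
    (fun τ hτ => hexp r right_mem_uIcc τ hτ) (fun τ hτ => by rw [hneg]; exact hr τ hτ)
    left_mem_uIcc right_mem_uIcc
  have e4 := im_sub_of_exp_eq (S := uIcc q s) isPreconnected_uIcc (L := fun τ => L (p, τ))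
    (F := fun τ => g p - g τ) (neg_ne_zero.2 hnp) (by fun_prop) (continuousOn_const.sub hJ)
    (fun τ hτ => hexp p left_mem_uIcc τ hτ) (fun τ hτ => by rw [hneg]; exact hp τ hτ)
    left_mem_uIcc right_mem_uIcc
  simp only [hneg] at e2 e4
  linarith

/-! ### Comparing arguments in a half plane by cross products -/

theorem re_div_nonneg {z n : ℂ} (h : 0 ≤ z.re * n.re + z.im * n.im) : 0 ≤ (z / n).re := by
  rw [Complex.div_re, ← add_div]
  exact div_nonneg h (Complex.normSq_nonneg _)

theorem sin_arg_sub_arg (z w : ℂ) :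
    ‖z‖ * ‖w‖ * Real.sin (w.arg - z.arg) = z.re * w.im - z.im * w.re := by
  rw [Real.sin_sub, ← Complex.norm_mul_cos_arg z, ← Complex.norm_mul_sin_arg z,
    ← Complex.norm_mul_cos_arg w, ← Complex.norm_mul_sin_arg w]
  ring

theorem arg_lt_of_cross_pos {z w : ℂ} (hz : 0 ≤ z.re) (hw : 0 ≤ w.re)
    (h : 0 < z.re * w.im - z.im * w.re) : z.arg < w.arg := by
  by_contra! hle
  have h1 := Complex.abs_arg_le_pi_div_two_iff.2 hz
  have h2 := Complex.abs_arg_le_pi_div_two_iff.2 hw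
  rw [abs_le] at h1 h2
  have h3 : Real.sin (w.arg - z.arg) ≤ 0 :=
    Real.sin_nonpos_of_nonpos_of_neg_pi_le (by linarith) (by linarith)
  have := sin_arg_sub_arg z w
  nlinarith [mul_nonneg (norm_nonneg z) (norm_nonneg w)]

/-- A vanishing cross product also allows opposite directions on the boundary of the half plane,
with arguments `π / 2` and `-π / 2`. The condition `ho` excludes exactly this. -/
theorem arg_le_of_cross_nonneg {z w : ℂ} (hz0 : z ≠ 0) (hw0 : w ≠ 0) (hz : 0 ≤ z.re)
    (hw : 0 ≤ w.re) (h : 0 ≤ z.re * w.im - z.im * w.re) (ho : z.im ≤ 0 ∨ 0 ≤ w.im) :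
    z.arg ≤ w.arg := by
  by_contra! hlt
  have h1 := Complex.abs_arg_le_pi_div_two_iff.2 hz
  have h2 := Complex.abs_arg_le_pi_div_two_iff.2 hw
  rw [abs_le] at h1 h2
  have h3 := sin_arg_sub_arg z w
  have hpos := mul_pos (norm_pos_iff.2 hz0) (norm_pos_iff.2 hw0)
  rcases h1.2.lt_or_eq with h4 | h4
  · have := Real.sin_neg_of_neg_of_neg_pi_lt (x := w.arg - z.arg) (by linarith) (by linarith)
    nlinarith
  rcases h2.1.lt_or_eq with h5 | h5
  · have := Real.sin_neg_of_neg_of_neg_pi_lt (x := w.arg - z.arg) (by linarith) (by linarith)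
    nlinarith
  have h6 := (Complex.arg_eq_pi_div_two_iff.1 h4).2
  have h7 : w.im < 0 := (Complex.arg_eq_neg_pi_div_two_iff.1 (by linarith)).2
  rcases ho with ho | ho <;> linarith

theorem cross_div (z w n : ℂ) : (z / n).re * (w / n).im - (z / n).im * (w / n).re =
    (z.re * w.im - z.im * w.re) / Complex.normSq n := by
  rcases eq_or_ne n 0 with rfl | hn
  · simp
  have : Complex.normSq n ≠ 0 := by simpa using hn
  have h : n.re * n.re + n.im * n.im = Complex.normSq n := (Complex.normSq_apply n).symm
  simp only [Complex.div_re, Complex.div_im]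
  field_simp
  rw [Complex.normSq_apply]
  ring

theorem arg_div_lt {z w n : ℂ} (hn : n ≠ 0) (hz : 0 ≤ z.re * n.re + z.im * n.im)
    (hw : 0 ≤ w.re * n.re + w.im * n.im) (h : 0 < z.re * w.im - z.im * w.re) :
    (z / n).arg < (w / n).arg := by
  apply arg_lt_of_cross_pos (re_div_nonneg hz) (re_div_nonneg hw)
  rw [cross_div]
  exact div_pos h (Complex.normSq_pos.2 hn)

theorem arg_div_le {z w n : ℂ} (hn : n ≠ 0) (hz0 : z ≠ 0) (hw0 : w ≠ 0)
    (hz : 0 ≤ z.re * n.re + z.im * n.im) (hw : 0 ≤ w.re * n.re + w.im * n.im)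
    (h : 0 ≤ z.re * w.im - z.im * w.re)
    (ho : z.im * n.re - z.re * n.im ≤ 0 ∨ 0 ≤ w.im * n.re - w.re * n.im) :
    (z / n).arg ≤ (w / n).arg := by
  have hpos := Complex.normSq_pos.2 hn
  apply arg_le_of_cross_nonneg (div_ne_zero hz0 hn) (div_ne_zero hw0 hn) (re_div_nonneg hz)
    (re_div_nonneg hw)
  · rw [cross_div]
    exact div_nonneg h hpos.le
  · simp only [Complex.div_im, ← sub_div]
    exact ho.imp (fun h => div_nonpos_of_nonpos_of_nonneg h hpos.le)
      (fun h => div_nonneg h hpos.le)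

theorem arg_ofReal_mul_neg_I_mul_div {n : ℂ} (hn : n ≠ 0) {ρ : ℝ} (hρ : 0 < ρ) :
    ((ρ * (-Complex.I * n)) / n).arg = -(Real.pi / 2) := by
  rw [← mul_assoc, mul_div_assoc, div_self hn, mul_one, Complex.arg_real_mul _ hρ,
    Complex.arg_neg_I]

theorem arg_neg_ofReal_mul_neg_I_mul_div {n : ℂ} (hn : n ≠ 0) {ρ : ℝ} (hρ : 0 < ρ) :
    (-(ρ * (-Complex.I * n)) / n).arg = Real.pi / 2 := by
  have : -(ρ * (-Complex.I * n)) / n = ρ * Complex.I := by field_simp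
  rw [this, Complex.arg_real_mul _ hρ, Complex.arg_I]

theorem eq_norm_mul_neg_I_of_arg {z : ℂ} (h : z.arg = -(Real.pi / 2)) :
    z = ‖z‖ * (-Complex.I) := by
  conv_lhs => rw [← Complex.norm_mul_exp_arg_mul_I z, h]
  rw [show ((-(Real.pi / 2) : ℝ) : ℂ) * Complex.I = -(Real.pi / 2 * Complex.I) by push_cast; ring,
    Complex.exp_neg, Complex.exp_pi_div_two_mul_I, Complex.inv_I]

theorem eq_norm_mul_I_of_arg {z : ℂ} (h : z.arg = Real.pi / 2) : z = ‖z‖ * Complex.I := by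
  conv_lhs => rw [← Complex.norm_mul_exp_arg_mul_I z, h]
  rw [show ((Real.pi / 2 : ℝ) : ℂ) = Real.pi / 2 by push_cast; ring, Complex.exp_pi_div_two_mul_I]

/-- A simple arc that touches two different support lines (unit inward normals `n₁`, `n₂`), the
first one in `γ p` and then in `γ q`, the second one in `γ r` and then in `γ s` (in the
counterclockwise order around the arc), cannot join `γ p` to `γ r` and `γ q` to `γ s` by disjoint
parts. -/
theorem not_disjoint_uIcc_of_support_lines {γ : ℝ → ℂ} {a b : ℝ} (hc : ContinuousOn γ (Icc a b))
    (hinj : InjOn γ (Icc a b)) {p q r s : ℝ} (hp : p ∈ Icc a b) (hq : q ∈ Icc a b)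
    (hr : r ∈ Icc a b) (hs : s ∈ Icc a b) {n₁ n₂ : ℂ} (hn₁ : ‖n₁‖ = 1) (hn₂ : ‖n₂‖ = 1)
    (hne : n₁ ≠ n₂) (h₁ : ∀ t ∈ Icc a b, 0 ≤ ((γ t - γ p) / n₁).re)
    (h₂ : ∀ t ∈ Icc a b, 0 ≤ ((γ t - γ r) / n₂).re) {ρ σ : ℝ} (hρ : 0 < ρ) (hσ : 0 < σ)
    (hpq : γ q - γ p = ρ * (-Complex.I * n₁)) (hrs : γ s - γ r = σ * (-Complex.I * n₂)) :
    ¬ Disjoint (uIcc p r) (uIcc q s) := by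
  intro hd
  have hn₁0 : n₁ ≠ 0 := by rintro rfl; simp at hn₁
  have hn₂0 : n₂ ≠ 0 := by rintro rfl; simp at hn₂
  have hI : uIcc p r ⊆ Icc a b := uIcc_subset_Icc hp hr
  have hJ : uIcc q s ⊆ Icc a b := uIcc_subset_Icc hq hs
  have hre : ∀ (ρ : ℝ) {n : ℂ}, n ≠ 0 → (ρ * (-Complex.I * n) / n).re = 0 := fun ρ n hn => by
    rw [← mul_assoc, mul_div_assoc, div_self hn, mul_one]; simp
  have h₁q : ∀ t ∈ Icc a b, 0 ≤ ((γ t - γ q) / n₁).re := fun t ht => by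
    have : γ t - γ q = (γ t - γ p) - ρ * (-Complex.I * n₁) := by rw [← hpq]; ring
    rw [this, sub_div, Complex.sub_re, hre ρ hn₁0, sub_zero]
    exact h₁ t ht
  have h₂s : ∀ t ∈ Icc a b, 0 ≤ ((γ t - γ s) / n₂).re := fun t ht => by
    have : γ t - γ s = (γ t - γ r) - σ * (-Complex.I * n₂) := by rw [← hrs]; ring
    rw [this, sub_div, Complex.sub_re, hre σ hn₂0, sub_zero]
    exact h₂ t ht
  have hsum := arg_sum_eq_zero (hc.mono hI) (hc.mono hJ)
    (fun σ hσ τ hτ h => hd.ne_of_mem hσ hτ (hinj (hI hσ) (hJ hτ) h)) hn₁0 hn₁0 hn₂0 hn₂0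
    (fun t ht => h₁ t (hJ ht)) (fun t ht => h₁q t (hI ht)) (fun t ht => h₂ t (hJ ht))
    (fun t ht => h₂s t (hI ht))
  rw [hpq, hrs, ← neg_sub (γ q) (γ p), ← neg_sub (γ s) (γ r), hpq, hrs,
    arg_ofReal_mul_neg_I_mul_div hn₁0 hρ, arg_ofReal_mul_neg_I_mul_div hn₂0 hσ,
    arg_neg_ofReal_mul_neg_I_mul_div hn₁0 hρ, arg_neg_ofReal_mul_neg_I_mul_div hn₂0 hσ] at hsum
  have b1 := abs_le.1 (Complex.abs_arg_le_pi_div_two_iff.2 (h₁ s hs))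
  have b2 := abs_le.1 (Complex.abs_arg_le_pi_div_two_iff.2 (h₁q r hr))
  have b3 := abs_le.1 (Complex.abs_arg_le_pi_div_two_iff.2 (h₂ q hq))
  have b4 := abs_le.1 (Complex.abs_arg_le_pi_div_two_iff.2 (h₂s p hp))
  -- The known arguments contribute `-2π` to the sum, and each of the other four is at most `π / 2`
  -- in absolute value, so all are extremal. Then `γ r - γ q` points along both support lines, which
  -- forces `n₁ = n₂`.
  have e2 := eq_norm_mul_I_of_arg (z := (γ r - γ q) / n₁) (by linarith)
  have e3 := eq_norm_mul_neg_I_of_arg (z := (γ q - γ r) / n₂) (by linarith)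
  rw [div_eq_iff hn₁0, norm_div, hn₁, div_one] at e2
  rw [div_eq_iff hn₂0, norm_div, hn₂, div_one, ← neg_sub, e2, norm_neg] at e3
  have hqr : γ q ≠ γ r := fun h =>
    hd.ne_of_mem right_mem_uIcc left_mem_uIcc (hinj hq hr h).symm
  have : (‖γ r - γ q‖ : ℂ) ≠ 0 := by
    simpa [sub_eq_zero] using hqr.symm
  apply hne
  have h5 : (‖γ r - γ q‖ : ℂ) * Complex.I * (n₁ - n₂) = 0 := by
    rw [norm_mul, norm_mul, Complex.norm_I, hn₁] at e3
    simp only [Complex.norm_real, norm_norm, mul_one] at e3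
    linear_combination -e3
  rcases mul_eq_zero.1 h5 with h6 | h6
  · simp [this] at h6
  · exact sub_eq_zero.1 h6

/-! ### Simple arcs in a quadrant -/

/-- The point `(u, v)` lies on the origin's side of the chord from `(x₁, 0)` to `(0, y₂)`: in the
scaled quantities, `m u + n v ≤ min (m x₁) (n y₂)` gives `u / x₁ + v / y₂ ≤ 1` when the denominators
are positive. -/
theorem cross_nonneg_of_near {m n x₁ y₂ u v : ℝ} (hm : 0 < m) (hn : 0 < n) (n1 : 0 ≤ x₁)
    (n2 : 0 ≤ y₂) (n3 : 0 ≤ u) (n4 : 0 ≤ v) (e1 : m * u + n * v ≤ m * x₁)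
    (e2 : m * u + n * v ≤ n * y₂) : 0 ≤ x₁ * (y₂ - v) - u * y₂ := by
  have hmn : 0 < m * n := mul_pos hm hn
  have : 0 ≤ (m * n) * (x₁ * (y₂ - v) - u * y₂) := by
    have a1 := mul_nonneg hm.le n1
    have a2 := mul_nonneg hn.le n2
    have a3 := mul_nonneg hm.le n3
    have a4 := mul_nonneg hn.le n4
    have : 0 ≤ (m * x₁) * (n * y₂) - (m * x₁) * (n * v) - (m * u) * (n * y₂) := by
      rcases le_total (m * x₁) (n * y₂) with h | h
      · nlinarith [mul_le_mul_of_nonneg_right h a4,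
          mul_nonneg a2 (sub_nonneg.2 e1)]
      · nlinarith [mul_le_mul_of_nonneg_right h a3, mul_nonneg a1 (sub_nonneg.2 e2)]
    linarith
  exact nonneg_of_mul_nonneg_right this hmn

/-- Now `(u, v)` lies beyond the chord from `(x₃, 0)` to `(0, y₂)`. If only one of `m`, `n` is
negative, already `x₃ ≤ u` or `y₂ ≤ v`; if both are, the estimate of `cross_nonneg_of_near` is
reversed. -/
theorem cross_nonneg_of_far {m n x₃ y₂ u v : ℝ} (hmn : m < 0 ∨ n < 0) (hx3 : 0 < x₃)
    (n2 : 0 ≤ y₂) (n3 : 0 ≤ u) (n4 : 0 ≤ v) (e2 : m * u + n * v ≤ n * y₂)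
    (e3 : m * u + n * v ≤ m * x₃) : 0 ≤ u * y₂ + v * x₃ - x₃ * y₂ := by
  have hcases : x₃ ≤ u ∨ y₂ ≤ v ∨ (m < 0 ∧ n < 0) := by
    rcases lt_or_ge m 0 with hm | hm
    · rcases lt_or_ge n 0 with hn | hn
      · exact Or.inr (Or.inr ⟨hm, hn⟩)
      · left; nlinarith [mul_nonneg hn n4]
    · right; left
      have hn : n < 0 := hmn.resolve_left (by linarith)
      nlinarith [mul_nonneg hm n3]
  rcases hcases with h | h | ⟨hm, hn⟩
  · nlinarith [mul_nonneg (sub_nonneg.2 h) n2, mul_nonneg n4 hx3.le]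
  · nlinarith [mul_nonneg (sub_nonneg.2 h) hx3.le, mul_nonneg n3 n2]
  · rcases le_total x₃ u with h | h
    · nlinarith [mul_nonneg (sub_nonneg.2 h) n2, mul_nonneg n4 hx3.le]
    · rcases le_total y₂ v with h' | h'
      · nlinarith [mul_nonneg (sub_nonneg.2 h') hx3.le, mul_nonneg n3 n2]
      · have : 0 ≤ (-m) * (-n) * (u * y₂ + v * x₃ - x₃ * y₂) := by
          have a1 := mul_nonneg (neg_pos.2 hm).le hx3.le
          have a2 := mul_nonneg (neg_pos.2 hn).le n2
          have a3 := mul_nonneg (neg_pos.2 hm).le n3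
          have a4 := mul_nonneg (neg_pos.2 hn).le n4
          have : 0 ≤ (-m * u) * (-n * y₂) + (-n * v) * (-m * x₃) - (-m * x₃) * (-n * y₂) := by
            rcases le_total (-m * x₃) (-n * y₂) <;> nlinarith
          linarith
        exact nonneg_of_mul_nonneg_right this (mul_pos (neg_pos.2 hm) (neg_pos.2 hn))

/-- Seen from `(u, v)`, this orders the directions to `(0, y₂)` and `(x₃, 0)`. The work is in the
collinear case, where opposite boundary directions in the wrong order must be ruled out. -/
theorem arg_le_of_far {m n x₃ y₂ u v : ℝ} (hmn : m < 0 ∨ n < 0) (hx3 : 0 < x₃)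
    (n2 : 0 ≤ y₂) (n3 : 0 ≤ u) (n4 : 0 ≤ v) (hne2 : ¬ (u = 0 ∧ v = y₂))
    (hne3 : ¬ (u = x₃ ∧ v = 0)) (e2 : m * u + n * v ≤ n * y₂) (e3 : m * u + n * v ≤ m * x₃) :
    ((⟨-u, y₂ - v⟩ : ℂ) / ⟨m, n⟩).arg ≤ ((⟨x₃ - u, -v⟩ : ℂ) / ⟨m, n⟩).arg := by
  have hcr3 := cross_nonneg_of_far hmn hx3 n2 n3 n4 e2 e3
  have hmn0 : (⟨m, n⟩ : ℂ) ≠ 0 := by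
    rw [Ne, Complex.ext_iff]; rintro ⟨h1, h2⟩; simp at h1 h2; rcases hmn with h | h <;> linarith
  have c1 : 0 ≤ -u * m + (y₂ - v) * n := by linarith
  have c2 : 0 ≤ (x₃ - u) * m + -v * n := by linarith
  rcases hcr3.lt_or_eq with h0 | h0
  · apply le_of_lt
    apply arg_div_lt hmn0 c1 c2
    change 0 < -u * -v - (y₂ - v) * (x₃ - u)
    linarith
  · apply arg_div_le hmn0 _ _ c1 c2
    · change 0 ≤ -u * -v - (y₂ - v) * (x₃ - u)
      linarith
    · change (y₂ - v) * m - -u * n ≤ 0 ∨ 0 ≤ -v * m - (x₃ - u) * n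
      rcases lt_or_ge m 0 with hm | hm
      · rcases le_total u x₃ with h1 | h1
        · right
          rcases lt_or_ge n 0 with hn | hn
          · nlinarith
          · have hu : x₃ ≤ u := by nlinarith [mul_nonneg hn n4]
            nlinarith [mul_nonneg hn (sub_nonneg.2 hu), mul_nonneg n4 (neg_nonneg.2 hm.le)]
        · rcases le_total v y₂ with h2 | h2
          · rcases lt_or_ge n 0 with hn | hn
            · left; nlinarith
            · right; nlinarith
          · have k1 := mul_nonneg (sub_nonneg.2 h1) n2
            have k2 := mul_nonneg n4 hx3.le
            have hv0 : v = 0 := by nlinarith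
            subst hv0
            rcases lt_or_ge n 0 with hn | hn
            · left
              have hy0 : y₂ * (u - x₃) = 0 := by linarith
              have hy : y₂ = 0 := (mul_eq_zero.1 hy0).resolve_right fun h' =>
                hne3 ⟨by linarith, rfl⟩
              rw [hy]
              nlinarith
            · right
              nlinarith [mul_nonneg hn (sub_nonneg.2 h1)]
      · left
        have hn : n < 0 := hmn.resolve_left (by linarith)
        have : y₂ ≤ v := by nlinarith [mul_nonneg hm n3]
        nlinarith [mul_nonneg hm (sub_nonneg.2 this)]
    · simp only [Ne, Complex.ext_iff, Complex.zero_re, Complex.zero_im]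
      rintro ⟨h1, h2⟩; exact hne2 ⟨by linarith, by linarith⟩
    · simp only [Ne, Complex.ext_iff, Complex.zero_re, Complex.zero_im]
      rintro ⟨h1, h2⟩; exact hne3 ⟨by linarith, by linarith⟩

/-- A simple arc in the closed first quadrant, given by its two coordinates. -/
structure IsQuadrantArc (x y : ℝ → ℝ) (a b : ℝ) : Prop where
  continuousOn_fst : ContinuousOn x (Icc a b)
  continuousOn_snd : ContinuousOn y (Icc a b)
  nonneg_fst : ∀ t ∈ Icc a b, 0 ≤ x t
  nonneg_snd : ∀ t ∈ Icc a b, 0 ≤ y t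
  inj : ∀ s ∈ Icc a b, ∀ t ∈ Icc a b, x s = x t → y s = y t → s = t

/-- The functional `m * x + n * y` takes its minimum over `[a, b]` in `t`. -/
def IsMinFunctional (x y : ℝ → ℝ) (a b m n t : ℝ) : Prop :=
  ∀ s ∈ Icc a b, m * x t + n * y t ≤ m * x s + n * y s

theorem arg_lt_of_re_eq_zero {z w : ℂ} (hz : z.re = 0) (hw : w.re = 0) (hz' : z.im < 0)
    (hw' : 0 < w.im) : z.arg < w.arg := by
  rw [Complex.arg_eq_neg_pi_div_two_iff.2 ⟨hz, hz'⟩, Complex.arg_eq_pi_div_two_iff.2 ⟨hw, hw'⟩]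
  linarith [Real.pi_pos]

namespace IsQuadrantArc

variable {x y : ℝ → ℝ} {a b : ℝ}

theorem arg_sum_eq_zero (h : IsQuadrantArc x y a b) {p q r s : ℝ} (hp : p ∈ Icc a b)
    (hq : q ∈ Icc a b) (hr : r ∈ Icc a b) (hs : s ∈ Icc a b) (hd : Disjoint (uIcc p r) (uIcc q s))
    {np nq nr ns : ℂ} (hnp : np ≠ 0) (hnq : nq ≠ 0) (hnr : nr ≠ 0) (hns : ns ≠ 0)
    (mp : IsMinFunctional x y a b np.re np.im p) (mq : IsMinFunctional x y a b nq.re nq.im q)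
    (mr : IsMinFunctional x y a b nr.re nr.im r) (ms : IsMinFunctional x y a b ns.re ns.im s) :
    (((⟨x q - x p, y q - y p⟩ : ℂ) / np).arg - ((⟨x s - x p, y s - y p⟩ : ℂ) / np).arg) +
    (((⟨x r - x q, y r - y q⟩ : ℂ) / nq).arg - ((⟨x p - x q, y p - y q⟩ : ℂ) / nq).arg) +
    (((⟨x s - x r, y s - y r⟩ : ℂ) / nr).arg - ((⟨x q - x r, y q - y r⟩ : ℂ) / nr).arg) +
    (((⟨x p - x s, y p - y s⟩ : ℂ) / ns).arg - ((⟨x r - x s, y r - y s⟩ : ℂ) / ns).arg) = 0 := by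
  have hI : uIcc p r ⊆ Icc a b := uIcc_subset_Icc hp hr
  have hJ : uIcc q s ⊆ Icc a b := uIcc_subset_Icc hq hs
  have hc : ContinuousOn (fun t => (⟨x t, y t⟩ : ℂ)) (Icc a b) := by
    have : (fun t => (⟨x t, y t⟩ : ℂ)) = fun t => (x t : ℂ) + y t * Complex.I := by
      funext t; exact Complex.mk_eq_add_mul_I _ _
    rw [this]
    exact (Complex.continuous_ofReal.comp_continuousOn h.1).add
      ((Complex.continuous_ofReal.comp_continuousOn h.2).mul continuousOn_const)
  have hre : ∀ {n : ℂ} {u : ℝ}, IsMinFunctional x y a b n.re n.im u → ∀ t ∈ Icc a b,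
      0 ≤ (((⟨x t, y t⟩ : ℂ) - ⟨x u, y u⟩) / n).re := fun {n u} hm t ht => by
    apply re_div_nonneg
    simp only [Complex.sub_re, Complex.sub_im]
    nlinarith [hm t ht]
  have := _root_.arg_sum_eq_zero (g := fun t => (⟨x t, y t⟩ : ℂ)) (hc.mono hI) (hc.mono hJ)
    (fun σ hσ τ hτ he => hd.ne_of_mem hσ hτ (h.5 σ (hI hσ) τ (hJ hτ)
      (congrArg Complex.re he) (congrArg Complex.im he))) hnp hnq hnr hns
    (fun t ht => hre mp t (hJ ht)) (fun t ht => hre mq t (hI ht))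
    (fun t ht => hre mr t (hJ ht)) (fun t ht => hre ms t (hI ht))
  have hsub : ∀ u v : ℝ, (⟨x u, y u⟩ : ℂ) - ⟨x v, y v⟩ = ⟨x u - x v, y u - y v⟩ :=
    fun u v => rfl
  simpa only [hsub] using this

theorem isMin_snd (h : IsQuadrantArc x y a b) {t : ℝ} (ht : y t = 0) :
    IsMinFunctional x y a b 0 1 t := fun s hs => by
  have := h.4 s hs; rw [ht]; linarith

theorem isMin_fst (h : IsQuadrantArc x y a b) {t : ℝ} (ht : x t = 0) :
    IsMinFunctional x y a b 1 0 t := fun s hs => by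
  have := h.3 s hs; rw [ht]; linarith

theorem disjoint_uIcc {p q r s : ℝ} (h : max p r < min q s) : Disjoint (uIcc p r) (uIcc q s) := by
  rw [uIcc, uIcc, Set.disjoint_left]
  intro t h1 h2
  exact absurd (h1.2.trans_lt (h.trans_le h2.1)) (lt_irrefl _)

/-- If the arc touches the second ray in between two contacts with the first ray, then it is not
contained in the line of the first ray. -/
theorem exists_snd_pos (h : IsQuadrantArc x y a b) {p₁ p₂ p₃ : ℝ} (h₁ : p₁ ∈ Icc a b)
    (h₃ : p₃ ∈ Icc a b) (h₁₂ : p₁ < p₂) (h₂₃ : p₂ < p₃) (x₂ : x p₂ = 0) :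
    ∃ t ∈ Icc a b, 0 < y t := by
  by_contra! hall
  have hy : ∀ t ∈ Icc a b, y t = 0 := fun t ht => le_antisymm (hall t ht) (h.4 t ht)
  have hI : Icc p₁ p₂ ⊆ Icc a b := Icc_subset_Icc h₁.1 (h₂₃.le.trans h₃.2)
  have hJ : Icc p₂ p₃ ⊆ Icc a b := Icc_subset_Icc (h₁.1.trans h₁₂.le) h₃.2
  have i1 := intermediate_value_Icc' h₁₂.le (h.1.mono hI)
  have i2 := intermediate_value_Icc h₂₃.le (h.1.mono hJ)
  -- On an arc inside one line, `x` takes the smaller of its two outer values on either side of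
  -- `p₂`. Injectivity then puts both parameters at `p₂`, where `x` is 0.
  obtain ⟨u, hu, hu'⟩ : min (x p₁) (x p₃) ∈ x '' Icc p₁ p₂ := i1
    ⟨by rw [x₂]; exact le_min (h.3 _ h₁) (h.3 _ h₃), min_le_left _ _⟩
  obtain ⟨v, hv, hv'⟩ : min (x p₁) (x p₃) ∈ x '' Icc p₂ p₃ := i2
    ⟨by rw [x₂]; exact le_min (h.3 _ h₁) (h.3 _ h₃), min_le_right _ _⟩
  have huv := h.5 u (hI hu) v (hJ hv) (hu'.trans hv'.symm) (by rw [hy u (hI hu), hy v (hJ hv)])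
  have hu2 : u = p₂ := le_antisymm hu.2 (huv ▸ hv.1)
  have h2 : p₂ ∈ Icc a b := hI (right_mem_Icc.2 h₁₂.le)
  rw [hu2, x₂] at hu'
  rcases min_choice (x p₁) (x p₃) with hm | hm
  · exact h₁₂.ne (h.5 _ h₁ _ h2 (by rw [x₂, ← hm, ← hu']) (by rw [hy _ h₁, hy _ h2]))
  · exact h₂₃.ne' (h.5 _ h₃ _ h2 (by rw [x₂, ← hm, ← hu']) (by rw [hy _ h₃, hy _ h2]))

/-- The arc touches the first ray in `p₁` and `p₃` and the second ray in between. A point with a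
support line that separates it from the interior of the angle (so that it faces the vertex) is not
passed later than `p₂`. -/
theorem le_of_isMin_near (h : IsQuadrantArc x y a b) {p₁ p₂ p₃ t m n : ℝ} (h₁ : p₁ ∈ Icc a b)
    (h₃ : p₃ ∈ Icc a b) (h₁₂ : p₁ < p₂) (h₂₃ : p₂ < p₃) (y₁ : y p₁ = 0) (y₃ : y p₃ = 0)
    (x₂ : x p₂ = 0) (hx : x p₁ < x p₃) (hm : 0 < m) (hn : 0 < n) (ht : t ∈ Icc a b)
    (hmin : IsMinFunctional x y a b m n t) : t ≤ p₂ := by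
  by_contra! hlt
  have h₂ : p₂ ∈ Icc a b := ⟨h₁.1.trans h₁₂.le, h₂₃.le.trans h₃.2⟩
  -- If `p₂ < t`, the parts `[p₁, p₂]` and `[p₃, t]` are disjoint. In the quadrilateral `p₁, p₃, p₂,
  -- t` every angle term is at most 0, and the one at `p₂` is negative (`b1` to `b4`).
  have hsum := h.arg_sum_eq_zero h₁ h₃ h₂ ht
    (disjoint_uIcc (by rw [max_eq_right h₁₂.le]; exact lt_min h₂₃ hlt))
    (np := ⟨0, 1⟩) (nq := ⟨0, 1⟩) (nr := ⟨1, 0⟩) (ns := ⟨m, n⟩)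
    (by simp [Complex.ext_iff]) (by simp [Complex.ext_iff]) (by simp [Complex.ext_iff])
    (by simp [Complex.ext_iff, hm.ne']) (h.isMin_snd y₁) (h.isMin_snd y₃) (h.isMin_fst x₂) hmin
  have e1 := hmin p₁ h₁
  have e2 := hmin p₂ h₂
  have ht1 : t ≠ p₁ := by linarith
  have n1 := h.3 _ h₁
  have n2 := h.4 _ h₂
  have n3 := h.3 _ ht
  have n4 := h.4 _ ht
  have hne2 : ¬ (x t = 0 ∧ y t = y p₂) := fun h' => hlt.ne'
    (h.5 t ht p₂ h₂ (by rw [h'.1, x₂]) h'.2)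
  have hne1 : ¬ (x t = x p₁ ∧ y t = 0) := fun h' => ht1
    (h.5 t ht p₁ h₁ h'.1 (by rw [h'.2, y₁]))
  have hne12 : ¬ (x p₁ = 0 ∧ y p₂ = 0) := fun h' => h₁₂.ne
    (h.5 p₁ h₁ p₂ h₂ (by rw [h'.1, x₂]) (by rw [h'.2, y₁]))
  simp only [y₁, y₃, x₂, sub_zero, zero_sub, mul_zero, add_zero, zero_add] at e1 e2 hsum
  generalize x p₁ = x₁ at *
  generalize x p₃ = x₃ at *
  generalize y p₂ = y₂ at *
  generalize x t = u at *
  generalize y t = v at *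
  have hu : u ≤ x₁ := by nlinarith
  have hv : v < y₂ := by
    refine lt_of_le_of_ne (by nlinarith) fun hv => hne2 ⟨?_, hv⟩
    subst hv
    nlinarith
  have hcr := cross_nonneg_of_near hm hn n1 n2 n3 n4 e1 e2
  have b1 : ((⟨x₃ - x₁, 0⟩ : ℂ) / ⟨0, 1⟩).arg ≤ ((⟨u - x₁, v⟩ : ℂ) / ⟨0, 1⟩).arg := by
    apply arg_div_le <;> simp [Complex.ext_iff]
    · linarith
    · intro h1 h2; exact hne1 ⟨by linarith, h2⟩
    · exact n4
    · nlinarith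
    · left; linarith
  have b2 : ((⟨-x₃, y₂⟩ : ℂ) / ⟨0, 1⟩).arg ≤ ((⟨x₁ - x₃, 0⟩ : ℂ) / ⟨0, 1⟩).arg := by
    apply arg_div_le <;> simp [Complex.ext_iff]
    · intro h; linarith
    · linarith
    · exact n2
    · nlinarith
    · right; linarith
  have b3 : ((⟨u, v - y₂⟩ : ℂ) / ⟨1, 0⟩).arg < ((⟨x₃, -y₂⟩ : ℂ) / ⟨1, 0⟩).arg := by
    apply arg_div_lt <;> simp [Complex.ext_iff]
    · exact n3
    · linarith
    · nlinarith
  have b4 : ((⟨x₁ - u, -v⟩ : ℂ) / ⟨m, n⟩).arg ≤ ((⟨-u, y₂ - v⟩ : ℂ) / ⟨m, n⟩).arg := by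
    apply arg_div_le <;> simp [Complex.ext_iff]
    · intro h; exact absurd h hm.ne'
    · intro h1 h2; exact hne1 ⟨by linarith, h2⟩
    · intro h1 h2; linarith
    · linarith
    · linarith
    · linarith
    · left; nlinarith
  linarith

/-- The arc touches the first ray in `p₁` and `p₃` and the second ray in between. A point with a
support line whose normal does not point into the angle (so that it faces away from the vertex) is
not passed earlier than `p₂`. -/
theorem le_of_isMin_far (h : IsQuadrantArc x y a b) {p₁ p₂ p₃ t m n : ℝ} (h₁ : p₁ ∈ Icc a b)
    (h₃ : p₃ ∈ Icc a b) (h₁₂ : p₁ < p₂) (h₂₃ : p₂ < p₃) (y₁ : y p₁ = 0) (y₃ : y p₃ = 0)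
    (x₂ : x p₂ = 0) (hx : x p₁ < x p₃) (hmn : m < 0 ∨ n < 0) (ht : t ∈ Icc a b)
    (hmin : IsMinFunctional x y a b m n t) : p₂ ≤ t := by
  by_contra! hlt
  have h₂ : p₂ ∈ Icc a b := ⟨h₁.1.trans h₁₂.le, h₂₃.le.trans h₃.2⟩
  -- If `t < p₂`, the disjoint parts join `p₁` to `t` and `p₃` to `p₂`. The quadrilateral is `p₁,
  -- p₃, t, p₂`, with the negative term at `p₁`.
  have hsum := h.arg_sum_eq_zero h₁ h₃ ht h₂
    (disjoint_uIcc (by rw [min_eq_right h₂₃.le]; exact max_lt h₁₂ hlt))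
    (np := ⟨0, 1⟩) (nq := ⟨0, 1⟩) (nr := ⟨m, n⟩) (ns := ⟨1, 0⟩)
    (by simp [Complex.ext_iff]) (by simp [Complex.ext_iff])
    (by rw [Ne, Complex.ext_iff]; rintro ⟨h1, h2⟩; simp at h1 h2
        rcases hmn with h | h <;> linarith)
    (by simp [Complex.ext_iff]) (h.isMin_snd y₁) (h.isMin_snd y₃) hmin (h.isMin_fst x₂)
  have e1 := hmin p₁ h₁
  have e2 := hmin p₂ h₂
  have e3 := hmin p₃ h₃
  have n1 := h.3 _ h₁
  have n2 := h.4 _ h₂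
  have n3 := h.3 _ ht
  have n4 := h.4 _ ht
  have hne2 : ¬ (x t = 0 ∧ y t = y p₂) := fun h' => hlt.ne
    (h.5 t ht p₂ h₂ (by rw [h'.1, x₂]) h'.2)
  -- A priori `t = p₁` is possible. Minimality would then force `m = 0`, `n < 0` and `y p₂ = 0`, and
  -- a point with positive `y` would have a smaller value.
  have hne1 : ¬ (x t = x p₁ ∧ y t = 0) := by
    rintro ⟨hx1, hy1⟩
    rw [hx1, hy1, mul_zero, add_zero] at e2 e3
    rw [x₂] at e2
    rw [y₃] at e3
    have hm : 0 ≤ m := by nlinarith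
    have hn : n < 0 := hmn.resolve_left (by linarith)
    have hx10 : m * x p₁ = 0 := by nlinarith [mul_nonneg hm n1]
    obtain ⟨s, hs, hs'⟩ := h.exists_snd_pos h₁ h₃ h₁₂ h₂₃ x₂
    have hy2 : y p₂ = 0 := by nlinarith
    have hm0 : m = 0 := (mul_eq_zero.1 hx10).resolve_right fun h' => h₁₂.ne
      (h.5 p₁ h₁ p₂ h₂ (by rw [h', x₂]) (by rw [hy2, y₁]))
    have := hmin s hs
    rw [hm0, hy1] at this
    nlinarith
  have hne3 : ¬ (x t = x p₃ ∧ y t = 0) := fun h' => (hlt.trans h₂₃).ne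
    (h.5 t ht p₃ h₃ h'.1 (by rw [h'.2, y₃]))
  have hne12 : ¬ (x p₁ = 0 ∧ y p₂ = 0) := fun h' => h₁₂.ne
    (h.5 p₁ h₁ p₂ h₂ (by rw [h'.1, x₂]) (by rw [h'.2, y₁]))
  simp only [y₁, y₃, x₂, sub_zero, zero_sub, mul_zero, add_zero, zero_add] at e1 e2 e3 hsum
  generalize x p₁ = x₁ at *
  generalize x p₃ = x₃ at *
  generalize y p₂ = y₂ at *
  generalize x t = u at *
  generalize y t = v at *
  have hx3 : 0 < x₃ := by linarith
  have hcr3 := cross_nonneg_of_far hmn hx3 n2 n3 n4 e2 e3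
  have hcr1 : 0 ≤ y₂ * u - x₁ * (y₂ - v) := by
    clear hsum
    nlinarith [mul_nonneg n3 n2]
  have b1 : ((⟨x₃ - x₁, 0⟩ : ℂ) / ⟨0, 1⟩).arg < ((⟨-x₁, y₂⟩ : ℂ) / ⟨0, 1⟩).arg := by
    rcases n2.lt_or_eq with h2 | h2
    · apply arg_div_lt <;> simp [Complex.ext_iff]
      · exact n2
      · nlinarith
    · subst h2
      have : 0 < x₁ := lt_of_le_of_ne n1 fun h' => hne12 ⟨h'.symm, rfl⟩
      apply arg_lt_of_re_eq_zero <;> simp [Complex.div_re, Complex.div_im, this, hx]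
  have b2 : ((⟨u - x₃, v⟩ : ℂ) / ⟨0, 1⟩).arg ≤ ((⟨x₁ - x₃, 0⟩ : ℂ) / ⟨0, 1⟩).arg := by
    apply arg_div_le <;> simp [Complex.ext_iff]
    · intro h1 h2; exact hne3 ⟨by linarith, h2⟩
    · linarith
    · exact n4
    · nlinarith
    · right; linarith
  have b3 := arg_le_of_far hmn hx3 n2 n3 n4 hne2 hne3 e2 e3
  have b4 : ((⟨x₁, -y₂⟩ : ℂ) / ⟨1, 0⟩).arg ≤ ((⟨u, v - y₂⟩ : ℂ) / ⟨1, 0⟩).arg := by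
    apply arg_div_le <;> simp [Complex.ext_iff]
    · intro h1 h2; exact hne12 ⟨h1, h2⟩
    · intro h1 h2; exact hne2 ⟨h1, by linarith⟩
    · exact n1
    · exact n3
    · nlinarith
    · left; exact n2
  linarith
end IsQuadrantArc

namespace IsQuadrantArc

variable {x y : ℝ → ℝ} {a b : ℝ}

/-- On one ray of the angle, the first and the last of three contacts cannot be joined by a part of
the arc that is disjoint from a part joining the middle one to a contact with the other ray. -/
theorem not_disjoint_of_lt_of_lt (h : IsQuadrantArc x y a b) {e l f τ : ℝ} (he : e ∈ Icc a b)
    (hl : l ∈ Icc a b) (hf : f ∈ Icc a b) (hτ : τ ∈ Icc a b) (ye : y e = 0) (yl : y l = 0)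
    (yf : y f = 0) (xτ : x τ = 0) (hel : x e < x l) (hlf : x l < x f) :
    ¬ Disjoint (uIcc e f) (uIcc l τ) := by
  intro hd
  -- The strict term is at `l`, which lies between `e` and `f` on the line: it equals `-π`. The
  -- other three are at most 0.
  have hsum := h.arg_sum_eq_zero he hl hf hτ hd
    (np := ⟨0, 1⟩) (nq := ⟨0, 1⟩) (nr := ⟨0, 1⟩) (ns := ⟨1, 0⟩)
    (by simp [Complex.ext_iff]) (by simp [Complex.ext_iff]) (by simp [Complex.ext_iff])
    (by simp [Complex.ext_iff]) (h.isMin_snd ye) (h.isMin_snd yl) (h.isMin_snd yf) (h.isMin_fst xτ)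
  have n1 := h.3 _ he
  have n2 := h.4 _ hτ
  have hne : ¬ (x e = 0 ∧ y τ = 0) := fun h' => hd.ne_of_mem left_mem_uIcc right_mem_uIcc
    (h.5 e he τ hτ (by rw [h'.1, xτ]) (by rw [h'.2, ye]))
  simp only [ye, yl, yf, xτ, sub_zero, zero_sub] at hsum
  generalize x e = x₁ at *
  generalize x l = x₂ at *
  generalize x f = x₃ at *
  generalize y τ = v at *
  have b1 : ((⟨x₂ - x₁, 0⟩ : ℂ) / ⟨0, 1⟩).arg ≤ ((⟨-x₁, v⟩ : ℂ) / ⟨0, 1⟩).arg := by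
    clear hsum
    apply arg_div_le <;> simp [Complex.ext_iff]
    · linarith
    · intro h1 h2; exact hne ⟨h1, h2⟩
    · exact n2
    · nlinarith
    · left; linarith
  have b2 : ((⟨x₃ - x₂, 0⟩ : ℂ) / ⟨0, 1⟩).arg < ((⟨x₁ - x₂, 0⟩ : ℂ) / ⟨0, 1⟩).arg := by
    clear hsum
    apply arg_lt_of_re_eq_zero <;> simp [Complex.div_re, Complex.div_im, hel, hlf]
  have b3 : ((⟨-x₃, v⟩ : ℂ) / ⟨0, 1⟩).arg ≤ ((⟨x₂ - x₃, 0⟩ : ℂ) / ⟨0, 1⟩).arg := by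
    clear hsum
    apply arg_div_le <;> simp [Complex.ext_iff]
    · intro h1; linarith
    · linarith
    · exact n2
    · nlinarith
    · right; linarith
  have b4 : ((⟨x₁, -v⟩ : ℂ) / ⟨1, 0⟩).arg ≤ ((⟨x₃, -v⟩ : ℂ) / ⟨1, 0⟩).arg := by
    clear hsum
    apply arg_div_le <;> simp [Complex.ext_iff]
    · intro h1 h2; exact hne ⟨h1, h2⟩
    · intro h1; linarith
    · exact n1
    · linarith
    · nlinarith
    · left; exact n2
  linarith

end IsQuadrantArc

/-! ### Oblique coordinates attached to an angle -/

/-- `γ`, restricted to `[a, b]`, is a simple arc. -/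
structure IsSimpleArc (γ : ℝ → ℂ) (a b : ℝ) : Prop where
  continuousOn : ContinuousOn γ (Icc a b)
  injOn : InjOn γ (Icc a b)

theorem neg_mem_Icc_neg {a b t : ℝ} (ht : t ∈ Icc (-b) (-a)) : -t ∈ Icc a b :=
  ⟨by linarith [ht.2], by linarith [ht.1]⟩

theorem neg_mem_Icc {a b t : ℝ} (ht : t ∈ Icc a b) : -t ∈ Icc (-b) (-a) :=
  ⟨by linarith [ht.2], by linarith [ht.1]⟩

theorem IsSimpleArc.reverse {γ : ℝ → ℂ} {a b : ℝ} (h : IsSimpleArc γ a b) :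
    IsSimpleArc (fun t => γ (-t)) (-b) (-a) :=
  ⟨h.1.comp continuous_neg.continuousOn fun _ => neg_mem_Icc_neg,
    fun _ hs _ ht he => neg_injective (h.2 (neg_mem_Icc_neg hs) (neg_mem_Icc_neg ht) he)⟩

namespace PlaneAngle

variable {θ : ℝ} {γ : ℝ → ℂ} {a b : ℝ}

theorem dir_sq (A : PlaneAngle θ) : A.dir.re * A.dir.re + A.dir.im * A.dir.im = 1 := by
  rw [← Complex.normSq_apply, Complex.normSq_eq_norm_sq, A.norm_dir, one_pow]

theorem rayDir_re_false (A : PlaneAngle θ) : (A.rayDir false).re = A.dir.re := rfl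
theorem rayDir_im_false (A : PlaneAngle θ) : (A.rayDir false).im = A.dir.im := rfl

theorem rayDir_re_true (A : PlaneAngle θ) :
    (A.rayDir true).re = A.dir.re * Real.cos θ - A.dir.im * Real.sin θ := by
  simp [rayDir, Complex.exp_ofReal_mul_I_re, Complex.exp_ofReal_mul_I_im]

theorem rayDir_im_true (A : PlaneAngle θ) :
    (A.rayDir true).im = A.dir.re * Real.sin θ + A.dir.im * Real.cos θ := by
  simp [rayDir, Complex.exp_ofReal_mul_I_re, Complex.exp_ofReal_mul_I_im]

theorem norm_rayDir (A : PlaneAngle θ) (i : Bool) : ‖A.rayDir i‖ = 1 := by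
  cases i
  · exact A.norm_dir
  · rw [rayDir, norm_mul, A.norm_dir, Complex.norm_exp_ofReal_mul_I, one_mul]

/-- The coordinates of a point with respect to the vertex and the directions of the two rays. -/
noncomputable def coord (A : PlaneAngle θ) : Bool → ℂ → ℝ
  | false, z => ((z.re - A.vertex.re) * (A.rayDir true).im -
      (z.im - A.vertex.im) * (A.rayDir true).re) / Real.sin θ
  | true, z => (A.dir.re * (z.im - A.vertex.im) - A.dir.im * (z.re - A.vertex.re)) / Real.sin θ

theorem eq_vertex_add_coord (A : PlaneAngle θ) (hθ : Real.sin θ ≠ 0) (i : Bool) (z : ℂ) :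
    z = A.vertex + A.coord i z * A.rayDir i + A.coord (!i) z * A.rayDir (!i) := by
  have h := A.dir_sq
  have h' := Real.sin_sq_add_cos_sq θ
  have key : z = A.vertex + A.coord false z * A.rayDir false + A.coord true z * A.rayDir true := by
    apply Complex.ext
    · simp only [Complex.add_re, Complex.re_ofReal_mul, coord, rayDir_re_false, rayDir_re_true,
        rayDir_im_true]
      field_simp
      linear_combination (-Real.sin θ * (z.re - A.vertex.re)) * h
    · simp only [Complex.add_im, Complex.im_ofReal_mul, coord, rayDir_im_false, rayDir_re_true,
        rayDir_im_true]
      field_simp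
      linear_combination (-Real.sin θ * (z.im - A.vertex.im)) * h
  cases i
  · exact key
  · rw [Bool.not_true, add_right_comm]; exact key

theorem coord_vertex_add (A : PlaneAngle θ) (hθ : Real.sin θ ≠ 0) (r s : ℝ) (i : Bool) :
    A.coord i (A.vertex + r * A.rayDir i + s * A.rayDir (!i)) = r := by
  have h := A.dir_sq
  have h' := Real.sin_sq_add_cos_sq θ
  cases i <;>
  · simp only [coord, Bool.not_false, Bool.not_true, Complex.add_re, Complex.add_im,
      Complex.re_ofReal_mul, Complex.im_ofReal_mul, rayDir_re_false, rayDir_im_false,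
      rayDir_re_true, rayDir_im_true]
    field_simp
    linear_combination (Real.sin θ * r) * h

theorem mem_ray_iff (A : PlaneAngle θ) (hθ : Real.sin θ ≠ 0) (i : Bool) (z : ℂ) :
    z ∈ A.ray i ↔ 0 ≤ A.coord i z ∧ A.coord (!i) z = 0 := by
  constructor
  · rintro ⟨r, hr, rfl⟩
    have h1 := A.coord_vertex_add hθ r 0 i
    have h2 := A.coord_vertex_add hθ 0 r (!i)
    simp only [Complex.ofReal_zero, zero_mul, add_zero, Bool.not_not] at h1 h2
    rw [h1, h2]
    exact ⟨hr, rfl⟩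
  · rintro ⟨h1, h2⟩
    refine ⟨_, h1, ?_⟩
    conv_lhs => rw [A.eq_vertex_add_coord hθ i z, h2]
    simp

theorem mem_line_iff (A : PlaneAngle θ) (hθ : Real.sin θ ≠ 0) (i : Bool) (z : ℂ) :
    z ∈ A.line i ↔ A.coord (!i) z = 0 := by
  constructor
  · rintro ⟨r, rfl⟩
    have h2 := A.coord_vertex_add hθ 0 r (!i)
    simpa only [Complex.ofReal_zero, zero_mul, add_zero, Bool.not_not] using h2
  · intro h2
    refine ⟨A.coord i z, ?_⟩
    conv_lhs => rw [A.eq_vertex_add_coord hθ i z, h2]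
    simp

theorem mem_region_iff (A : PlaneAngle θ) (hθ : Real.sin θ ≠ 0) (z : ℂ) :
    z ∈ A.region ↔ ∀ i, 0 ≤ A.coord i z := by
  constructor
  · rintro ⟨r, s, hr, hs, rfl⟩ i
    cases i
    · exact hr.trans_eq (A.coord_vertex_add hθ r s false).symm
    · rw [add_right_comm]; exact hs.trans_eq (A.coord_vertex_add hθ s r true).symm
  · intro h
    exact ⟨_, _, h false, h true, A.eq_vertex_add_coord hθ false z⟩

theorem Contains.nonneg {A : PlaneAngle θ} (h : A.Contains γ a b) (hθ : Real.sin θ ≠ 0) (i : Bool)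
    {t : ℝ} (ht : t ∈ Icc a b) : 0 ≤ A.coord i (γ t) :=
  (A.mem_region_iff hθ _).1 (h (mem_image_of_mem γ ht)) i

theorem Contains.mem_ray_iff {A : PlaneAngle θ} (h : A.Contains γ a b) (hθ : Real.sin θ ≠ 0)
    (i : Bool) {t : ℝ} (ht : t ∈ Icc a b) : γ t ∈ A.ray i ↔ A.coord (!i) (γ t) = 0 := by
  rw [PlaneAngle.mem_ray_iff A hθ, and_iff_right (h.nonneg hθ i ht)]

theorem continuous_coord (A : PlaneAngle θ) (i : Bool) : Continuous (A.coord i) := by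
  cases i <;> (unfold coord; fun_prop)

theorem ext_coord (A : PlaneAngle θ) (hθ : Real.sin θ ≠ 0) (i : Bool) {z w : ℂ}
    (h : A.coord i z = A.coord i w) (h' : A.coord (!i) z = A.coord (!i) w) : z = w := by
  rw [A.eq_vertex_add_coord hθ i z, A.eq_vertex_add_coord hθ i w, h, h']

theorem Contains.isQuadrantArc {A : PlaneAngle θ} (h : A.Contains γ a b) (hθ : Real.sin θ ≠ 0)
    (hγ : IsSimpleArc γ a b) (i : Bool) :
    IsQuadrantArc (fun t => A.coord i (γ t)) (fun t => A.coord (!i) (γ t)) a b :=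
  ⟨(A.continuous_coord i).comp_continuousOn hγ.1, (A.continuous_coord _).comp_continuousOn hγ.1,
    fun _ ht => h.nonneg hθ _ ht, fun _ ht => h.nonneg hθ _ ht,
    fun _ hs _ ht h1 h2 => hγ.2 hs ht (A.ext_coord hθ i h1 h2)⟩

theorem wbtw_of_coord_le (A : PlaneAngle θ) (hθ : Real.sin θ ≠ 0) (i : Bool) {z w : ℂ}
    (hz : A.coord (!i) z = 0) (hw : A.coord (!i) w = 0) (h0 : 0 ≤ A.coord i z)
    (hle : A.coord i z ≤ A.coord i w) : Wbtw ℝ A.vertex z w := by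
  have ez := A.eq_vertex_add_coord hθ i z
  have ew := A.eq_vertex_add_coord hθ i w
  rw [hz, Complex.ofReal_zero, zero_mul, add_zero] at ez
  rw [hw, Complex.ofReal_zero, zero_mul, add_zero] at ew
  rcases h0.lt_or_eq with hpos | h00
  · refine ⟨A.coord i z / A.coord i w, ⟨div_nonneg h0 (h0.trans hle),
      div_le_one_of_le₀ hle (h0.trans hle)⟩, ?_⟩
    have hw0 : (A.coord i w : ℂ) ≠ 0 := by exact_mod_cast (hpos.trans_le hle).ne'
    have : A.coord i z / A.coord i w * (w - A.vertex) = z - A.vertex := by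
      have ez' : z - A.vertex = A.coord i z * A.rayDir i := by linear_combination ez
      have ew' : w - A.vertex = A.coord i w * A.rayDir i := by linear_combination ew
      rw [ez', ew']
      field_simp
    rw [AffineMap.lineMap_apply, vsub_eq_sub, vadd_eq_add, Complex.real_smul, Complex.ofReal_div,
      this, sub_add_cancel]
  · rw [← h00] at ez
    have : z = A.vertex := by simpa using ez
    rw [this]
    exact wbtw_self_left ℝ _ _

/-! ### Reversal of the arc -/

theorem Contains.reverse {A : PlaneAngle θ} (h : A.Contains γ a b) :
    A.Contains (fun t => γ (-t)) (-b) (-a) := by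
  rintro _ ⟨t, ht, rfl⟩
  exact h (mem_image_of_mem γ (neg_mem_Icc_neg ht))

theorem AlternatesAt.reverse {A : PlaneAngle θ} {i : Bool} {p q r : ℝ}
    (h : A.AlternatesAt γ a b i p q r) :
    A.AlternatesAt (fun t => γ (-t)) (-b) (-a) i (-r) (-q) (-p) := by
  obtain ⟨h1, h2, h3, h4, h5, h6, h7⟩ := h
  refine ⟨neg_le_neg h4, neg_lt_neg h3, neg_lt_neg h2, neg_le_neg h1, ?_, ?_, ?_⟩ <;>
    simpa only [neg_neg]

theorem Interlace.of_reverse {A B : PlaneAngle θ}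
    (h : A.Interlace B (fun t => γ (-t)) (-b) (-a)) : B.Interlace A γ a b := by
  have hrev : ∀ {C : PlaneAngle θ} {i : Bool} {p q r : ℝ},
      C.AlternatesAt (fun t => γ (-t)) (-b) (-a) i p q r →
      C.AlternatesAt γ a b i (-r) (-q) (-p) := fun h => by
    simpa only [neg_neg] using h.reverse
  rcases h with ⟨i, p, q, r, s, h1, h2, h3, h4, h5, h6⟩ | ⟨hl, i, j, p₁, p₂, p₃, q₁, q₂, q₃, h1, h2,
    h3, h4, h5⟩
  · left
    refine ⟨!i, -s, -r, -q, -p, ?_, neg_le_neg h2, hrev h4, ?_, h6.symm, h5.symm⟩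
    · rw [Bool.not_not, h1]
    · rw [Bool.not_not]; exact hrev h3
  · right
    refine ⟨fun i j => (hl j i).symm, j, i, -q₃, -q₂, -q₁, -p₃, -p₂, -p₁, hrev h2, hrev h1, h4.symm,
      h3.symm, ?_⟩
    rcases h5 with ⟨e, h6, h7, h8⟩ | ⟨e, h6⟩ | ⟨e, h6⟩
    · exact Or.inl ⟨e.symm, by linarith, by linarith, by linarith⟩
    · exact Or.inr (Or.inl ⟨by rw [e, Bool.not_not], by linarith⟩)
    · exact Or.inr (Or.inr ⟨e.symm, by linarith⟩)

end PlaneAngle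

/-! ### Change of coordinates between two angles; forward and backward triples -/

namespace PlaneAngle

variable {θ : ℝ} {γ : ℝ → ℂ} {a b : ℝ}

/-- The cosine of the angle from the first ray of `A` to the first ray of `B`. -/
def cosTo (A B : PlaneAngle θ) : ℝ := A.dir.re * B.dir.re + A.dir.im * B.dir.im

/-- The sine of the angle from the first ray of `A` to the first ray of `B`. -/
def sinTo (A B : PlaneAngle θ) : ℝ := A.dir.re * B.dir.im - A.dir.im * B.dir.re

theorem cosTo_comm (A B : PlaneAngle θ) : B.cosTo A = A.cosTo B := by unfold cosTo; ring

theorem sinTo_comm (A B : PlaneAngle θ) : B.sinTo A = -A.sinTo B := by unfold sinTo; ring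

theorem sinTo_sq_add_cosTo_sq (A B : PlaneAngle θ) : A.sinTo B ^ 2 + A.cosTo B ^ 2 = 1 := by
  unfold sinTo cosTo
  linear_combination (B.dir.re * B.dir.re + B.dir.im * B.dir.im) * A.dir_sq + B.dir_sq

theorem dir_re_eq (A B : PlaneAngle θ) :
    B.dir.re = A.dir.re * A.cosTo B - A.dir.im * A.sinTo B := by
  unfold sinTo cosTo; linear_combination -B.dir.re * A.dir_sq

theorem dir_im_eq (A B : PlaneAngle θ) :
    B.dir.im = A.dir.im * A.cosTo B + A.dir.re * A.sinTo B := by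
  unfold sinTo cosTo; linear_combination -B.dir.im * A.dir_sq

theorem sub_re_eq (A : PlaneAngle θ) (hθ : Real.sin θ ≠ 0) (z w : ℂ) :
    z.re - w.re = (A.coord false z - A.coord false w) * A.dir.re +
      (A.coord true z - A.coord true w) * (A.rayDir true).re := by
  have h1 := congrArg Complex.re (A.eq_vertex_add_coord hθ false z)
  have h2 := congrArg Complex.re (A.eq_vertex_add_coord hθ false w)
  simp only [Complex.add_re, Complex.re_ofReal_mul, rayDir_re_false, Bool.not_false] at h1 h2
  linear_combination h1 - h2

theorem sub_im_eq (A : PlaneAngle θ) (hθ : Real.sin θ ≠ 0) (z w : ℂ) :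
    z.im - w.im = (A.coord false z - A.coord false w) * A.dir.im +
      (A.coord true z - A.coord true w) * (A.rayDir true).im := by
  have h1 := congrArg Complex.im (A.eq_vertex_add_coord hθ false z)
  have h2 := congrArg Complex.im (A.eq_vertex_add_coord hθ false w)
  simp only [Complex.add_im, Complex.im_ofReal_mul, rayDir_im_false, Bool.not_false] at h1 h2
  linear_combination h1 - h2

theorem sin_mul_coord_true_sub (A : PlaneAngle θ) (hθ : Real.sin θ ≠ 0) (z w : ℂ) :
    Real.sin θ * (A.coord true z - A.coord true w) =
      A.dir.re * (z.im - w.im) - A.dir.im * (z.re - w.re) := by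
  unfold coord; field_simp; ring

theorem sin_mul_coord_false_sub (A : PlaneAngle θ) (hθ : Real.sin θ ≠ 0) (z w : ℂ) :
    Real.sin θ * (A.coord false z - A.coord false w) =
      (z.re - w.re) * (A.rayDir true).im - (z.im - w.im) * (A.rayDir true).re := by
  unfold coord; field_simp; ring

/-- With `φ` the rotation from `A` to `B`, the coefficients are `-sin φ` and `sin (θ - φ)`; in
`coord_false_sub` they are `sin (θ + φ)` and `sin φ`. Their signs decide which of `le_of_near` and
`le_of_far` applies to a ray of `B`. -/
theorem coord_true_sub (A B : PlaneAngle θ) (hθ : Real.sin θ ≠ 0) (z w : ℂ) :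
    Real.sin θ * (B.coord true z - B.coord true w) =
      -A.sinTo B * (A.coord false z - A.coord false w) +
      (Real.sin θ * A.cosTo B - Real.cos θ * A.sinTo B) * (A.coord true z - A.coord true w) := by
  rw [B.sin_mul_coord_true_sub hθ, A.sub_re_eq hθ, A.sub_im_eq hθ, A.dir_re_eq B, A.dir_im_eq B,
    rayDir_re_true, rayDir_im_true]
  linear_combination (-A.sinTo B * (A.coord false z - A.coord false w) +
    (Real.sin θ * A.cosTo B - Real.cos θ * A.sinTo B) *
      (A.coord true z - A.coord true w)) * A.dir_sq

theorem coord_false_sub (A B : PlaneAngle θ) (hθ : Real.sin θ ≠ 0) (z w : ℂ) :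
    Real.sin θ * (B.coord false z - B.coord false w) =
      (Real.sin θ * A.cosTo B + Real.cos θ * A.sinTo B) * (A.coord false z - A.coord false w) +
      A.sinTo B * (A.coord true z - A.coord true w) := by
  rw [B.sin_mul_coord_false_sub hθ, A.sub_re_eq hθ, A.sub_im_eq hθ, rayDir_re_true, rayDir_im_true,
    rayDir_re_true, rayDir_im_true, A.dir_re_eq B, A.dir_im_eq B]
  have h' := Real.sin_sq_add_cos_sq θ
  linear_combination ((Real.sin θ * A.cosTo B + Real.cos θ * A.sinTo B) *
      (A.coord false z - A.coord false w) +
      A.sinTo B * (A.coord true z - A.coord true w)) * A.dir_sq +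
      A.sinTo B * (A.coord true z - A.coord true w) *
      (A.dir.re * A.dir.re + A.dir.im * A.dir.im) * h'

/-- The arc touches the ray `i` in `p₁` and `p₃`, and the other ray in between, and `γ p₁` is nearer
to the vertex than `γ p₃`: seen along the arc, the vertex is behind. -/
def IsForwardAt (A : PlaneAngle θ) (γ : ℝ → ℂ) (a b : ℝ) (i : Bool) (p₁ p₂ p₃ : ℝ) : Prop :=
  A.AlternatesAt γ a b i p₁ p₂ p₃ ∧ A.coord i (γ p₁) < A.coord i (γ p₃)

/-- The arc touches the ray `i` in `p₁` and `p₃`, and the other ray in between, and `γ p₃` is nearer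
to the vertex than `γ p₁`: seen along the arc, the vertex is ahead. -/
def IsBackwardAt (A : PlaneAngle θ) (γ : ℝ → ℂ) (a b : ℝ) (i : Bool) (p₁ p₂ p₃ : ℝ) : Prop :=
  A.AlternatesAt γ a b i p₁ p₂ p₃ ∧ A.coord i (γ p₃) < A.coord i (γ p₁)

theorem IsForwardAt.reverse {A : PlaneAngle θ} {i : Bool} {p q r : ℝ}
    (h : A.IsForwardAt γ a b i p q r) :
    A.IsBackwardAt (fun t => γ (-t)) (-b) (-a) i (-r) (-q) (-p) :=
  ⟨h.1.reverse, by simpa only [neg_neg] using h.2⟩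

theorem IsBackwardAt.reverse {A : PlaneAngle θ} {i : Bool} {p q r : ℝ}
    (h : A.IsBackwardAt γ a b i p q r) :
    A.IsForwardAt (fun t => γ (-t)) (-b) (-a) i (-r) (-q) (-p) :=
  ⟨h.1.reverse, by simpa only [neg_neg] using h.2⟩

section AlternatesAt

variable {A : PlaneAngle θ} {i : Bool} {p₁ p₂ p₃ : ℝ}

theorem AlternatesAt.mem₁ (h : A.AlternatesAt γ a b i p₁ p₂ p₃) : p₁ ∈ Icc a b :=
  ⟨h.1, by linarith [h.2.1, h.2.2.1, h.2.2.2.1]⟩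

theorem AlternatesAt.mem₂ (h : A.AlternatesAt γ a b i p₁ p₂ p₃) : p₂ ∈ Icc a b :=
  ⟨by linarith [h.1, h.2.1], by linarith [h.2.2.1, h.2.2.2.1]⟩

theorem AlternatesAt.mem₃ (h : A.AlternatesAt γ a b i p₁ p₂ p₃) : p₃ ∈ Icc a b :=
  ⟨by linarith [h.1, h.2.1, h.2.2.1], h.2.2.2.1⟩

theorem AlternatesAt.coord₁ (h : A.AlternatesAt γ a b i p₁ p₂ p₃) (hθ : Real.sin θ ≠ 0) :
    A.coord (!i) (γ p₁) = 0 := ((A.mem_ray_iff hθ _ _).1 h.2.2.2.2.1).2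

theorem AlternatesAt.coord₂ (h : A.AlternatesAt γ a b i p₁ p₂ p₃) (hθ : Real.sin θ ≠ 0) :
    A.coord i (γ p₂) = 0 := by
  simpa using ((A.mem_ray_iff hθ _ _).1 h.2.2.2.2.2.1).2

theorem AlternatesAt.coord₃ (h : A.AlternatesAt γ a b i p₁ p₂ p₃) (hθ : Real.sin θ ≠ 0) :
    A.coord (!i) (γ p₃) = 0 := ((A.mem_ray_iff hθ _ _).1 h.2.2.2.2.2.2).2

theorem alternatesAt_of_coord (hA : A.Contains γ a b) (hθ : Real.sin θ ≠ 0)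
    (h₁ : p₁ ∈ Icc a b) (h₃ : p₃ ∈ Icc a b) (h₁₂ : p₁ < p₂) (h₂₃ : p₂ < p₃)
    (c₁ : A.coord (!i) (γ p₁) = 0) (c₂ : A.coord i (γ p₂) = 0) (c₃ : A.coord (!i) (γ p₃) = 0) :
    A.AlternatesAt γ a b i p₁ p₂ p₃ :=
  ⟨h₁.1, h₁₂, h₂₃, h₃.2, (hA.mem_ray_iff hθ _ h₁).2 c₁,
    (hA.mem_ray_iff hθ _ ⟨h₁.1.trans h₁₂.le, h₂₃.le.trans h₃.2⟩).2 (by simpa using c₂),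
    (hA.mem_ray_iff hθ _ h₃).2 c₃⟩

theorem AlternatesAt.isForwardAt_or_isBackwardAt (h : A.AlternatesAt γ a b i p₁ p₂ p₃)
    (hθ : Real.sin θ ≠ 0) (hγ : IsSimpleArc γ a b) :
    A.IsForwardAt γ a b i p₁ p₂ p₃ ∨ A.IsBackwardAt γ a b i p₁ p₂ p₃ := by
  rcases lt_trichotomy (A.coord i (γ p₁)) (A.coord i (γ p₃)) with h' | h' | h'
  · exact Or.inl ⟨h, h'⟩
  · have := hγ.2 h.mem₁ h.mem₃ (A.ext_coord hθ i h' (by rw [h.coord₁ hθ, h.coord₃ hθ]))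
    linarith [h.2.1, h.2.2.1]
  · exact Or.inr ⟨h, h'⟩

theorem AlternatesAt.exists_coord_pos (h : A.AlternatesAt γ a b i p₁ p₂ p₃)
    (hθ : Real.sin θ ≠ 0) (hγ : IsSimpleArc γ a b) (hA : A.Contains γ a b) (j : Bool) :
    ∃ t ∈ Icc a b, 0 < A.coord j (γ t) := by
  by_cases hj : j = !i
  · subst hj
    exact (hA.isQuadrantArc hθ hγ i).exists_snd_pos h.mem₁ h.mem₃ h.2.1 h.2.2.1 (h.coord₂ hθ)
  · obtain rfl : j = i := by revert hj; cases j <;> cases i <;> simp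
    rcases h.isForwardAt_or_isBackwardAt hθ hγ with h' | h'
    · exact ⟨p₃, h.mem₃, (hA.nonneg hθ _ h.mem₁).trans_lt h'.2⟩
    · exact ⟨p₁, h.mem₁, (hA.nonneg hθ _ h.mem₃).trans_lt h'.2⟩

end AlternatesAt

section Forward

variable {A : PlaneAngle θ} {i : Bool} {p₁ p₂ p₃ : ℝ}

theorem IsForwardAt.le_of_near (h : A.IsForwardAt γ a b i p₁ p₂ p₃) (hθ : Real.sin θ ≠ 0)
    (hγ : IsSimpleArc γ a b) (hA : A.Contains γ a b) {m n t : ℝ} (hm : 0 < m) (hn : 0 < n)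
    (ht : t ∈ Icc a b) (hmin : ∀ s ∈ Icc a b,
      0 ≤ m * (A.coord false (γ s) - A.coord false (γ t)) +
        n * (A.coord true (γ s) - A.coord true (γ t))) : t ≤ p₂ := by
  have hQ := hA.isQuadrantArc hθ hγ i
  cases i
  · exact hQ.le_of_isMin_near h.1.mem₁ h.1.mem₃ h.1.2.1 h.1.2.2.1 (h.1.coord₁ hθ) (h.1.coord₃ hθ)
      (h.1.coord₂ hθ) h.2 hm hn ht fun s hs => by simp only [Bool.not_false]; linarith [hmin s hs]
  · exact hQ.le_of_isMin_near h.1.mem₁ h.1.mem₃ h.1.2.1 h.1.2.2.1 (h.1.coord₁ hθ) (h.1.coord₃ hθ)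
      (h.1.coord₂ hθ) h.2 hn hm ht fun s hs => by simp only [Bool.not_true]; linarith [hmin s hs]

theorem IsForwardAt.le_of_far (h : A.IsForwardAt γ a b i p₁ p₂ p₃) (hθ : Real.sin θ ≠ 0)
    (hγ : IsSimpleArc γ a b) (hA : A.Contains γ a b) {m n t : ℝ} (hmn : m < 0 ∨ n < 0)
    (ht : t ∈ Icc a b) (hmin : ∀ s ∈ Icc a b,
      0 ≤ m * (A.coord false (γ s) - A.coord false (γ t)) +
        n * (A.coord true (γ s) - A.coord true (γ t))) : p₂ ≤ t := by
  have hQ := hA.isQuadrantArc hθ hγ i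
  cases i
  · exact hQ.le_of_isMin_far h.1.mem₁ h.1.mem₃ h.1.2.1 h.1.2.2.1 (h.1.coord₁ hθ) (h.1.coord₃ hθ)
      (h.1.coord₂ hθ) h.2 hmn ht fun s hs => by simp only [Bool.not_false]; linarith [hmin s hs]
  · exact hQ.le_of_isMin_far h.1.mem₁ h.1.mem₃ h.1.2.1 h.1.2.2.1 (h.1.coord₁ hθ) (h.1.coord₃ hθ)
      (h.1.coord₂ hθ) h.2 hmn.symm ht fun s hs => by
        simp only [Bool.not_true]; linarith [hmin s hs]

theorem Contains.not_disjoint_of_coord_lt (hA : A.Contains γ a b) (hθ : Real.sin θ ≠ 0)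
    (hγ : IsSimpleArc γ a b) (i : Bool) {e l f τ : ℝ} (he : e ∈ Icc a b)
    (hl : l ∈ Icc a b) (hf : f ∈ Icc a b) (hτ : τ ∈ Icc a b) (ye : A.coord (!i) (γ e) = 0)
    (yl : A.coord (!i) (γ l) = 0) (yf : A.coord (!i) (γ f) = 0) (xτ : A.coord i (γ τ) = 0)
    (hel : A.coord i (γ e) < A.coord i (γ l)) (hlf : A.coord i (γ l) < A.coord i (γ f)) :
    ¬ Disjoint (uIcc e f) (uIcc l τ) :=
  (hA.isQuadrantArc hθ hγ i).not_disjoint_of_lt_of_lt he hl hf hτ ye yl yf xτ hel hlf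

end Forward

section Pair

variable {A B : PlaneAngle θ}

/-- `B.coord true` vanishes on the line of the first ray of `B` and is nonnegative on the arc, so a
contact minimises it. Written in coordinates of `A`, this is the minimality assumption of
`le_of_near` and `le_of_far`. -/
theorem Contains.coord_true_sub_nonneg (hB : B.Contains γ a b) (hθ : 0 < Real.sin θ)
    (A : PlaneAngle θ) {t : ℝ} (ht : B.coord true (γ t) = 0) {s : ℝ} (hs : s ∈ Icc a b) :
    0 ≤ -A.sinTo B * (A.coord false (γ s) - A.coord false (γ t)) +
      (Real.sin θ * A.cosTo B - Real.cos θ * A.sinTo B) *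
        (A.coord true (γ s) - A.coord true (γ t)) := by
  rw [← A.coord_true_sub B hθ.ne', ht, sub_zero]
  exact mul_nonneg hθ.le (hB.nonneg hθ.ne' _ hs)

theorem Contains.coord_false_sub_nonneg (hB : B.Contains γ a b) (hθ : 0 < Real.sin θ)
    (A : PlaneAngle θ) {t : ℝ} (ht : B.coord false (γ t) = 0) {s : ℝ} (hs : s ∈ Icc a b) :
    0 ≤ (Real.sin θ * A.cosTo B + Real.cos θ * A.sinTo B) *
        (A.coord false (γ s) - A.coord false (γ t)) +
      A.sinTo B * (A.coord true (γ s) - A.coord true (γ t)) := by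
  rw [← A.coord_false_sub B hθ.ne', ht, sub_zero]
  exact mul_nonneg hθ.le (hB.nonneg hθ.ne' _ hs)

/-- The inward unit normals of the two rays. -/
noncomputable def normal (A : PlaneAngle θ) : Bool → ℂ
  | false => Complex.I * A.dir
  | true => -(Complex.I * A.rayDir true)

theorem norm_normal (A : PlaneAngle θ) (i : Bool) : ‖A.normal i‖ = 1 := by
  cases i
  · simp [normal, A.norm_dir]
  · simp [normal, A.norm_rayDir]

theorem re_sub_div_normal (A : PlaneAngle θ) (hθ : Real.sin θ ≠ 0) (i : Bool) (z w : ℂ) :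
    ((z - w) / A.normal i).re = Real.sin θ * (A.coord (!i) z - A.coord (!i) w) := by
  have hn : Complex.normSq (A.normal i) = 1 := by
    rw [Complex.normSq_eq_norm_sq, A.norm_normal, one_pow]
  rw [Complex.div_re, hn, div_one, div_one]
  cases i
  · rw [Bool.not_false, A.sin_mul_coord_true_sub hθ]
    simp [normal]; ring
  · rw [Bool.not_true, A.sin_mul_coord_false_sub hθ]
    simp [normal]; ring

theorem sub_eq_mul_rayDir (A : PlaneAngle θ) (hθ : Real.sin θ ≠ 0) (i : Bool) {z w : ℂ}
    (hz : A.coord (!i) z = 0) (hw : A.coord (!i) w = 0) :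
    z - w = ((A.coord i z - A.coord i w : ℝ) : ℂ) * A.rayDir i := by
  have h1 := A.eq_vertex_add_coord hθ i z
  have h2 := A.eq_vertex_add_coord hθ i w
  rw [hz] at h1
  rw [hw] at h2
  push_cast at *
  linear_combination h1 - h2

/-- The points of the line of the ray `i` in the counterclockwise order around the region. -/
def Precedes (A : PlaneAngle θ) : Bool → ℂ → ℂ → Prop
  | false, z, w => A.coord false z < A.coord false w
  | true, z, w => A.coord true w < A.coord true z

theorem Precedes.exists_sub_eq {A : PlaneAngle θ} {i : Bool} {z w : ℂ} (h : A.Precedes i z w)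
    (hθ : Real.sin θ ≠ 0) (hz : A.coord (!i) z = 0) (hw : A.coord (!i) w = 0) :
    ∃ ρ : ℝ, 0 < ρ ∧ w - z = ρ * (-Complex.I * A.normal i) := by
  have hsub := A.sub_eq_mul_rayDir hθ i hw hz
  cases i
  · refine ⟨_, sub_pos.2 h, ?_⟩
    rw [hsub, normal, ← mul_assoc (-Complex.I), neg_mul, Complex.I_mul_I, neg_neg, one_mul]
    rfl
  · refine ⟨_, sub_pos.2 h, ?_⟩
    rw [hsub, normal, neg_mul_neg, ← mul_assoc Complex.I, Complex.I_mul_I]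
    push_cast
    ring

theorem Contains.not_disjoint_of_precedes (hA : A.Contains γ a b) (hB : B.Contains γ a b)
    (hθ : 0 < Real.sin θ) (hγ : IsSimpleArc γ a b) {i j : Bool} {p q r s : ℝ}
    (hp : p ∈ Icc a b) (hq : q ∈ Icc a b) (hr : r ∈ Icc a b) (hs : s ∈ Icc a b)
    (cp : A.coord (!i) (γ p) = 0) (cq : A.coord (!i) (γ q) = 0) (cr : B.coord (!j) (γ r) = 0)
    (cs : B.coord (!j) (γ s) = 0) (hne : A.normal i ≠ B.normal j)
    (hpq : A.Precedes i (γ p) (γ q)) (hrs : B.Precedes j (γ r) (γ s)) :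
    ¬ Disjoint (uIcc p r) (uIcc q s) := by
  obtain ⟨ρ, hρ, e1⟩ := hpq.exists_sub_eq hθ.ne' cp cq
  obtain ⟨σ, hσ, e2⟩ := hrs.exists_sub_eq hθ.ne' cr cs
  refine not_disjoint_uIcc_of_support_lines hγ.1 hγ.2 hp hq hr hs (A.norm_normal i)
    (B.norm_normal j) hne (fun t ht => ?_) (fun t ht => ?_) hρ hσ e1 e2
  · rw [A.re_sub_div_normal hθ.ne', cp, sub_zero]
    exact mul_nonneg hθ.le (hA.nonneg hθ.ne' _ ht)
  · rw [B.re_sub_div_normal hθ.ne', cr, sub_zero]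
    exact mul_nonneg hθ.le (hB.nonneg hθ.ne' _ ht)

end Pair

end PlaneAngle

/-! ### Relative position of two angles -/

namespace PlaneAngle

variable {θ : ℝ} {γ : ℝ → ℂ} {a b : ℝ} {A B : PlaneAngle θ}

/-- Equal inward normals of these two rays mean that the rotation from `A` to `B` is `π - θ`. -/
theorem sinTo_eq_of_normal_eq (h : A.normal false = B.normal true) :
    A.sinTo B = Real.sin θ ∧ A.cosTo B = -Real.cos θ := by
  have h1 : A.dir = -B.rayDir true := by
    apply mul_left_cancel₀ Complex.I_ne_zero
    rw [mul_neg]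
    exact h
  have h2 := congrArg Complex.re h1
  have h3 := congrArg Complex.im h1
  simp only [Complex.neg_re, Complex.neg_im, rayDir_re_true, rayDir_im_true] at h2 h3
  have := B.dir_sq
  unfold sinTo cosTo
  rw [h2, h3]
  constructor
  · linear_combination Real.sin θ * B.dir_sq
  · linear_combination -Real.cos θ * B.dir_sq

theorem AlternatesAt.exists_coord_eq_zero {i : Bool} {p₁ p₂ p₃ : ℝ}
    (h : A.AlternatesAt γ a b i p₁ p₂ p₃) (hθ : Real.sin θ ≠ 0) (j : Bool) :
    ∃ t ∈ Icc a b, A.coord j (γ t) = 0 := by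
  have h1 := h.coord₁ hθ
  have h2 := h.coord₂ hθ
  cases i <;> cases j
  exacts [⟨p₂, h.mem₂, h2⟩, ⟨p₁, h.mem₁, h1⟩, ⟨p₁, h.mem₁, h1⟩, ⟨p₂, h.mem₂, h2⟩]

/-- Two angles with the same directions of the rays that contain the arc and are touched by it on
both rays are equal. -/
theorem eq_of_sinTo_eq_zero (hA : A.Contains γ a b) (hB : B.Contains γ a b) (hθ : 0 < Real.sin θ)
    (tA : ∀ j, ∃ t ∈ Icc a b, A.coord j (γ t) = 0) (tB : ∀ j, ∃ t ∈ Icc a b, B.coord j (γ t) = 0)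
    (hs : A.sinTo B = 0) (hc : A.cosTo B = 1) : A = B := by
  have hsub : ∀ j z w, B.coord j z - B.coord j w = A.coord j z - A.coord j w := by
    intro j z w
    have h1 := A.coord_true_sub B hθ.ne' z w
    have h2 := A.coord_false_sub B hθ.ne' z w
    rw [hs, hc] at h1 h2
    apply mul_left_cancel₀ hθ.ne'
    cases j
    · rw [h2]; ring
    · rw [h1]; ring
  have hv : ∀ j, B.coord j A.vertex = 0 := by
    intro j
    obtain ⟨t, ht, h1⟩ := tA j
    obtain ⟨s, hs, h2⟩ := tB j
    have h3 := hA.nonneg hθ.ne' j hs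
    have h4 := hB.nonneg hθ.ne' j ht
    have h5 := hsub j (γ t) (γ s)
    have h6 := hsub j A.vertex (γ t)
    have h7 : A.coord j A.vertex = 0 := by
      simpa using A.coord_vertex_add hθ.ne' 0 0 j
    linarith
  apply PlaneAngle.ext
  · rw [B.eq_vertex_add_coord hθ.ne' false A.vertex, hv, hv]; simp
  · apply Complex.ext
    · rw [A.dir_re_eq B, hs, hc]; ring
    · rw [A.dir_im_eq B, hs, hc]; ring

/-- By `h₁` and `h₂`, the normals of both rays of `B` have a negative coefficient in the coordinates
of `A`. -/
theorem IsForwardAt.le_of_far_rays {i : Bool} {p₁ p₂ p₃ : ℝ} (h : A.IsForwardAt γ a b i p₁ p₂ p₃)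
    (hA : A.Contains γ a b) (hB : B.Contains γ a b) (hθ : 0 < Real.sin θ) (hγ : IsSimpleArc γ a b)
    (h₁ : 0 < A.sinTo B ∨ Real.sin θ * A.cosTo B - Real.cos θ * A.sinTo B < 0)
    (h₂ : Real.sin θ * A.cosTo B + Real.cos θ * A.sinTo B < 0 ∨ A.sinTo B < 0)
    {j : Bool} {t : ℝ} (ht : t ∈ Icc a b) (hj : B.coord j (γ t) = 0) : p₂ ≤ t := by
  cases j
  · exact h.le_of_far hθ.ne' hγ hA h₂ ht fun s hs => hB.coord_false_sub_nonneg hθ A hj hs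
  · exact h.le_of_far hθ.ne' hγ hA (h₁.imp_left neg_neg_iff_pos.2) ht fun s hs =>
      hB.coord_true_sub_nonneg hθ A hj hs

/-- The first ray of `B` lies far from the vertex of `A`. -/
theorem IsForwardAt.le_of_first_ray {i : Bool} {p₁ p₂ p₃ : ℝ} (h : A.IsForwardAt γ a b i p₁ p₂ p₃)
    (hA : A.Contains γ a b) (hB : B.Contains γ a b) (hθ : 0 < Real.sin θ) (hγ : IsSimpleArc γ a b)
    (h₁ : 0 < A.sinTo B) {t : ℝ} (ht : t ∈ Icc a b) (hj : B.coord true (γ t) = 0) : p₂ ≤ t :=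
  h.le_of_far hθ.ne' hγ hA (Or.inl (neg_neg_iff_pos.2 h₁)) ht fun _ hs =>
      hB.coord_true_sub_nonneg hθ A hj hs

/-- The second ray of `A` lies far from the vertex of `B`. -/
theorem IsForwardAt.le_of_second_ray {j : Bool} {q₁ q₂ q₃ : ℝ}
    (h : B.IsForwardAt γ a b j q₁ q₂ q₃)
    (hA : A.Contains γ a b) (hB : B.Contains γ a b) (hθ : 0 < Real.sin θ) (hγ : IsSimpleArc γ a b)
    (h₁ : 0 < A.sinTo B) {t : ℝ} (ht : t ∈ Icc a b) (hj : A.coord false (γ t) = 0) : q₂ ≤ t :=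
  h.le_of_far hθ.ne' hγ hB (Or.inr (by rw [sinTo_comm]; exact neg_neg_iff_pos.2 h₁)) ht fun _ hs =>
      hA.coord_false_sub_nonneg hθ B hj hs

theorem IsBackwardAt.le_of_second_ray {j : Bool} {q₁ q₂ q₃ : ℝ}
    (h : B.IsBackwardAt γ a b j q₁ q₂ q₃)
    (hA : A.Contains γ a b) (hB : B.Contains γ a b) (hθ : 0 < Real.sin θ) (hγ : IsSimpleArc γ a b)
    (h₁ : 0 < A.sinTo B) {t : ℝ} (ht : t ∈ Icc a b) (hj : A.coord false (γ t) = 0) : t ≤ q₂ :=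
  neg_le_neg_iff.1 (h.reverse.le_of_second_ray hA.reverse hB.reverse hθ hγ.reverse h₁
    (neg_mem_Icc ht) (by simpa only [neg_neg] using hj))

/-- If the rays of `A` and `B` interlace around the arc, then not both angles are alternating. -/
theorem IsForwardAt.not_alternatesAt {i j : Bool} {p₁ p₂ p₃ q₁ q₂ q₃ : ℝ}
    (h : A.IsForwardAt γ a b i p₁ p₂ p₃)
    (hA : A.Contains γ a b) (hB : B.Contains γ a b) (hθ : 0 < Real.sin θ) (hγ : IsSimpleArc γ a b)
    (h₁ : 0 < A.sinTo B) (h₂ : 0 < Real.sin θ * A.cosTo B + Real.cos θ * A.sinTo B) :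
    ¬ B.AlternatesAt γ a b j q₁ q₂ q₃ := by
  intro hq
  have near : ∀ t ∈ Icc a b, B.coord false (γ t) = 0 → t ≤ p₂ := fun t ht hj =>
    h.le_of_near hθ.ne' hγ hA h₂ h₁ ht fun s hs => hB.coord_false_sub_nonneg hθ A hj hs
  have far : ∀ t ∈ Icc a b, B.coord true (γ t) = 0 → p₂ ≤ t := fun t ht hj =>
    h.le_of_first_ray hA hB hθ hγ h₁ ht hj
  obtain ⟨-, k1, k2, -⟩ := id hq
  cases j
  · linarith [near _ hq.mem₂ (hq.coord₂ hθ.ne'), far _ hq.mem₁ (hq.coord₁ hθ.ne')]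
  · linarith [far _ hq.mem₂ (hq.coord₂ hθ.ne'), near _ hq.mem₃ (hq.coord₃ hθ.ne')]

/-- The assumptions place the rotation in `(π - θ, π]`. The second alternative is needed at `π`,
where the sine vanishes and the cosine is negative. -/
theorem far_of_sinTo_nonneg (hs : 0 ≤ A.sinTo B)
    (hσ : Real.sin θ * A.cosTo B + Real.cos θ * A.sinTo B < 0) :
    0 < A.sinTo B ∨ Real.sin θ * A.cosTo B - Real.cos θ * A.sinTo B < 0 := by
  rcases hs.lt_or_eq with h | h
  · exact Or.inl h
  · right; rw [← h] at hσ ⊢; linarith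

/-! ### Rotation in `(π - θ, π]`: four different lines -/

section FourLines

theorem IsForwardAt.le_of_mem_right {i j : Bool} {p₁ p₂ p₃ t : ℝ}
    (h : A.IsForwardAt γ a b i p₁ p₂ p₃)
    (hA : A.Contains γ a b) (hB : B.Contains γ a b) (hθ : 0 < Real.sin θ) (hγ : IsSimpleArc γ a b)
    (hs : 0 ≤ A.sinTo B) (hσ : Real.sin θ * A.cosTo B + Real.cos θ * A.sinTo B < 0)
    (ht : t ∈ Icc a b) (hj : B.coord j (γ t) = 0) : p₂ ≤ t :=
  h.le_of_far_rays hA hB hθ hγ (far_of_sinTo_nonneg hs hσ) (Or.inl hσ) ht hj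

/-- Seen from `B` the rotation is `-φ`, which exchanges the roles of the two normals, so both rays
of `A` are far from the vertex of `B` as well. -/
theorem IsForwardAt.le_of_mem_left {i j : Bool} {q₁ q₂ q₃ t : ℝ}
    (h : B.IsForwardAt γ a b i q₁ q₂ q₃)
    (hA : A.Contains γ a b) (hB : B.Contains γ a b) (hθ : 0 < Real.sin θ) (hγ : IsSimpleArc γ a b)
    (hs : 0 ≤ A.sinTo B) (hσ : Real.sin θ * A.cosTo B + Real.cos θ * A.sinTo B < 0)
    (ht : t ∈ Icc a b) (hj : A.coord j (γ t) = 0) : q₂ ≤ t := by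
  refine h.le_of_far_rays hB hA hθ hγ ?_ ?_ ht hj
  · right; rw [cosTo_comm, sinTo_comm]; linarith
  · rw [cosTo_comm, sinTo_comm]
    exact (far_of_sinTo_nonneg hs hσ).symm.imp (fun h => by linarith) neg_neg_iff_pos.2

theorem IsBackwardAt.le_of_mem_left {i j : Bool} {q₁ q₂ q₃ t : ℝ}
    (h : B.IsBackwardAt γ a b i q₁ q₂ q₃)
    (hA : A.Contains γ a b) (hB : B.Contains γ a b) (hθ : 0 < Real.sin θ) (hγ : IsSimpleArc γ a b)
    (hs : 0 ≤ A.sinTo B) (hσ : Real.sin θ * A.cosTo B + Real.cos θ * A.sinTo B < 0)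
    (ht : t ∈ Icc a b) (hj : A.coord j (γ t) = 0) : t ≤ q₂ :=
  neg_le_neg_iff.1 (h.reverse.le_of_mem_left hA.reverse hB.reverse hθ hγ.reverse hs hσ
    (neg_mem_Icc ht) (by simpa only [neg_neg] using hj))

/-- A shared line makes a coefficient of the coordinate change vanish. Either the sign assumptions
exclude this, or the two regions lie on opposite sides of the line, whereas an alternating arc has a
point off it. -/
theorem line_ne_line (hA : A.IsAlternating γ a b) (hB : B.Contains γ a b)
    (hθ : 0 < Real.sin θ) (hγ : IsSimpleArc γ a b) (hs : 0 ≤ A.sinTo B)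
    (hσ : Real.sin θ * A.cosTo B + Real.cos θ * A.sinTo B < 0) (i j : Bool) :
    A.line i ≠ B.line j := by
  intro hl
  obtain ⟨hA, k, p₁, p₂, p₃, hp⟩ := hA
  have hfar := far_of_sinTo_nonneg hs hσ
  have hz : ∀ r : ℝ, B.coord (!j) (A.vertex + r * A.rayDir i) = 0 := fun r => by
    rw [← B.mem_line_iff hθ.ne', ← hl]
    exact ⟨r, rfl⟩
  have c1 : ∀ r : ℝ, A.coord i (A.vertex + r * A.rayDir i) = r := fun r => by
    simpa using A.coord_vertex_add hθ.ne' r 0 i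
  have c2 : ∀ r : ℝ, A.coord (!i) (A.vertex + r * A.rayDir i) = 0 := fun r => by
    simpa using A.coord_vertex_add hθ.ne' 0 r (!i)
  have e1 := A.coord_true_sub B hθ.ne' (A.vertex + (1 : ℝ) * A.rayDir i)
    (A.vertex + (0 : ℝ) * A.rayDir i)
  have e2 := A.coord_false_sub B hθ.ne' (A.vertex + (1 : ℝ) * A.rayDir i)
    (A.vertex + (0 : ℝ) * A.rayDir i)
  have f1 := fun t => A.coord_true_sub B hθ.ne' (γ t) (A.vertex + (0 : ℝ) * A.rayDir i)
  have f2 := fun t => A.coord_false_sub B hθ.ne' (γ t) (A.vertex + (0 : ℝ) * A.rayDir i)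
  have hz0 := hz 0
  have hz1 := hz 1
  have c10 := c1 0
  have c11 := c1 1
  have c20 := c2 0
  have c21 := c2 1
  obtain ⟨t, ht, hpos⟩ := hp.exists_coord_pos hθ.ne' hγ hA (!i)
  cases i <;> cases j <;> simp only [Bool.not_false, Bool.not_true] at hz0 hz1 c10 c11 c20 c21 hpos
  · rw [hz0, hz1, c10, c11, c20, c21] at e1
    have hs0 : A.sinTo B = 0 := by linarith
    have h1 := f1 t
    rw [hz0, c10, c20, hs0] at h1
    have h2 := hB.nonneg hθ.ne' true ht
    rw [hs0] at hσ
    nlinarith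
  · rw [hz0, hz1, c10, c11, c20, c21] at e2
    linarith
  · rw [hz0, hz1, c10, c11, c20, c21] at e1
    have h0 : Real.sin θ * A.cosTo B - Real.cos θ * A.sinTo B = 0 := by linarith
    have hs0 : 0 < A.sinTo B := hfar.resolve_right (by linarith)
    have h1 := f1 t
    rw [hz0, c10, c20, h0] at h1
    have h2 := hB.nonneg hθ.ne' true ht
    nlinarith
  · rw [hz0, hz1, c10, c11, c20, c21] at e2
    have hs0 : A.sinTo B = 0 := by linarith
    have h1 := f2 t
    rw [hz0, c10, c20, hs0] at h1
    have h2 := hB.nonneg hθ.ne' false ht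
    rw [hs0] at hσ
    nlinarith

theorem normal_false_ne_true (hσ : Real.sin θ * A.cosTo B + Real.cos θ * A.sinTo B < 0) :
    A.normal false ≠ B.normal true := fun h => by
  rw [(sinTo_eq_of_normal_eq h).1, (sinTo_eq_of_normal_eq h).2] at hσ
  linarith

theorem normal_true_ne_false (hθ : 0 < Real.sin θ) (hs : 0 ≤ A.sinTo B) :
    B.normal false ≠ A.normal true := fun h => by
  have := (sinTo_eq_of_normal_eq h).1
  rw [sinTo_comm] at this
  linarith

/-- If `q₁ = p₃`, the point is on both rays `i`. A second contact on one of these rays would leave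
the other angle unless the lines are parallel; then they coincide, with the regions on opposite
sides. -/
theorem ne_of_isForwardAt_of_isBackwardAt {i : Bool} {p₁ p₂ p₃ q₁ q₂ q₃ : ℝ}
    (hp : A.IsForwardAt γ a b i p₁ p₂ p₃) (hq : B.IsBackwardAt γ a b i q₁ q₂ q₃)
    (hA : A.Contains γ a b) (hB : B.Contains γ a b) (hθ : 0 < Real.sin θ) (hγ : IsSimpleArc γ a b)
    (hs : 0 ≤ A.sinTo B) (hσ : Real.sin θ * A.cosTo B + Real.cos θ * A.sinTo B < 0) :
    q₁ ≠ p₃ := by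
  intro he
  obtain ⟨t, ht, hpos⟩ := hp.1.exists_coord_pos hθ.ne' hγ hA (!i)
  have a1 := hp.1.coord₁ hθ.ne'
  have a3 := hp.1.coord₃ hθ.ne'
  have b1 := hq.1.coord₁ hθ.ne'
  have b3 := hq.1.coord₃ hθ.ne'
  have hlt := hq.2
  rw [he] at b1 hlt
  have hn := hA.nonneg hθ.ne' (!i) hq.1.mem₃
  have hn' := hB.nonneg hθ.ne' (!i) ht
  have hn'' := hB.nonneg hθ.ne' (!i) hp.1.mem₁
  have hltp := hp.2
  cases i <;> simp only [Bool.not_false, Bool.not_true] at *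
  · have h1 := B.coord_true_sub A hθ.ne' (γ q₃) (γ p₃)
    rw [a3, b1, b3, sinTo_comm] at h1
    have hs0 : A.sinTo B = 0 := by nlinarith
    have h2 := A.coord_true_sub B hθ.ne' (γ t) (γ p₃)
    rw [a3, b1, hs0] at h2
    rw [hs0] at hσ
    nlinarith
  · have h1 := A.coord_false_sub B hθ.ne' (γ p₁) (γ p₃)
    rw [a1, a3, b1] at h1
    have hs0 : A.sinTo B = 0 := by nlinarith
    have h2 := A.coord_false_sub B hθ.ne' (γ t) (γ p₃)
    rw [a3, b1, hs0] at h2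
    rw [hs0] at hσ
    nlinarith

end FourLines

end PlaneAngle

theorem disjoint_uIcc_of_max_lt_min {p q r s : ℝ} (h₁ : p < q) (h₂ : p < s) (h₃ : r < q)
    (h₄ : r < s) : Disjoint (uIcc p r) (uIcc q s) :=
  IsQuadrantArc.disjoint_uIcc (max_lt (lt_min h₁ h₂) (lt_min h₃ h₄))

theorem disjoint_uIcc_of_max_lt_min' {p q r s : ℝ} (h₁ : q < p) (h₂ : s < p) (h₃ : q < r)
    (h₄ : s < r) : Disjoint (uIcc p r) (uIcc q s) :=
  (disjoint_uIcc_of_max_lt_min h₁ h₃ h₂ h₄).symm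

namespace PlaneAngle

variable {θ : ℝ} {γ : ℝ → ℂ} {a b : ℝ} {A B : PlaneAngle θ}

theorem interlaceFourLines {i j : Bool} {p₁ p₂ p₃ q₁ q₂ q₃ : ℝ}
    (hp : A.IsForwardAt γ a b i p₁ p₂ p₃) (hq : B.IsBackwardAt γ a b j q₁ q₂ q₃)
    (hA : A.Contains γ a b) (hB : B.Contains γ a b) (hθ : 0 < Real.sin θ) (hγ : IsSimpleArc γ a b)
    (hs : 0 ≤ A.sinTo B) (hσ : Real.sin θ * A.cosTo B + Real.cos θ * A.sinTo B < 0) :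
    A.InterlaceFourLines B γ a b := by
  have h1 : p₂ ≤ q₁ := hp.le_of_mem_right hA hB hθ hγ hs hσ hq.1.mem₁ (hq.1.coord₁ hθ.ne')
  have h2 : p₃ ≤ q₂ := hq.le_of_mem_left hA hB hθ hγ hs hσ hp.1.mem₃ (hp.1.coord₃ hθ.ne')
  obtain ⟨-, k1, k2, -⟩ := id hp.1
  obtain ⟨-, k3, k4, -⟩ := id hq.1
  refine ⟨line_ne_line ⟨hA, i, p₁, p₂, p₃, hp.1⟩ hB hθ hγ hs hσ, i, j, p₁, p₂, p₃, q₁, q₂, q₃,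
    hp.1, hq.1, ?_, ?_, ?_⟩
  · exact A.wbtw_of_coord_le hθ.ne' i (hp.1.coord₁ hθ.ne') (hp.1.coord₃ hθ.ne')
      (hA.nonneg hθ.ne' _ hp.1.mem₁) hp.2.le
  · exact (B.wbtw_of_coord_le hθ.ne' j (hq.1.coord₃ hθ.ne') (hq.1.coord₁ hθ.ne')
      (hB.nonneg hθ.ne' _ hq.1.mem₃) hq.2.le).symm
  by_cases hij : j = i
  · subst hij
    rcases lt_or_gt_of_ne (ne_of_isForwardAt_of_isBackwardAt hp hq hA hB hθ hγ hs hσ) with h | h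
    · exact Or.inl ⟨rfl, h1, h, h2⟩
    · exact Or.inr (Or.inr ⟨rfl, h⟩)
  · have hj : j = !i := by revert hij; cases i <;> cases j <;> simp
    refine Or.inr (Or.inl ⟨hj, ?_⟩)
    -- If `q₁ < p₃`, then since `p₃ ≤ q₂ < q₃` the parts from `p₁` to `q₁` and from `p₃` to `q₃` are
    -- disjoint.
    by_contra! hlt
    subst hj
    have hp2 := hp.2
    have hq2 := hq.2
    cases i <;> simp only [Bool.not_false, Bool.not_true] at *
    · exact hA.not_disjoint_of_precedes hB hθ hγ (i := false) (j := true) hp.1.mem₁ hp.1.mem₃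
        hq.1.mem₁ hq.1.mem₃ (hp.1.coord₁ hθ.ne') (hp.1.coord₃ hθ.ne') (hq.1.coord₁ hθ.ne')
        (hq.1.coord₃ hθ.ne') (normal_false_ne_true hσ) hp2 hq2
        (disjoint_uIcc_of_max_lt_min (by linarith) (by linarith) hlt (by linarith))
    · exact hB.not_disjoint_of_precedes hA hθ hγ (i := false) (j := true) hq.1.mem₃ hq.1.mem₁
        hp.1.mem₃ hp.1.mem₁ (hq.1.coord₃ hθ.ne') (hq.1.coord₁ hθ.ne') (hp.1.coord₃ hθ.ne')
        (hp.1.coord₁ hθ.ne') (normal_true_ne_false hθ hs) hq2 hp2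
        (disjoint_uIcc_of_max_lt_min' (by linarith) (by linarith) hlt (by linarith))

/-! ### Rotation equal to `π - θ`: a common line -/

section CommonLine

theorem sinTo_eq_of_common_line (hθ : 0 < Real.sin θ) (hs : 0 < A.sinTo B)
    (hσ : Real.sin θ * A.cosTo B + Real.cos θ * A.sinTo B = 0) : A.sinTo B = Real.sin θ := by
  have h1 := A.sinTo_sq_add_cosTo_sq B
  have h2 := Real.sin_sq_add_cos_sq θ
  have h3 : A.sinTo B ^ 2 = Real.sin θ ^ 2 := by
    linear_combination Real.sin θ ^ 2 * h1 - A.sinTo B ^ 2 * h2 -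
      (Real.sin θ * A.cosTo B - Real.cos θ * A.sinTo B) * hσ
  rw [sq_eq_sq₀ hs.le hθ.le] at h3
  exact h3

/-- Both coordinates measure the distance from parallel lines with the same scale and orientation.
Each is nonnegative on the arc and vanishes somewhere on it, so the additive constants agree. -/
theorem coord_false_eq_coord_true (hA : A.Contains γ a b) (hB : B.Contains γ a b)
    (hθ : 0 < Real.sin θ) (tA : ∃ t ∈ Icc a b, A.coord true (γ t) = 0)
    (tB : ∃ t ∈ Icc a b, B.coord false (γ t) = 0) (hs : 0 < A.sinTo B)
    (hσ : Real.sin θ * A.cosTo B + Real.cos θ * A.sinTo B = 0) (z : ℂ) :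
    B.coord false z = A.coord true z := by
  have hsub : ∀ z w, B.coord false z - B.coord false w = A.coord true z - A.coord true w := by
    intro z w
    have h2 := A.coord_false_sub B hθ.ne' z w
    rw [hσ, sinTo_eq_of_common_line hθ hs hσ, zero_mul, zero_add] at h2
    exact mul_left_cancel₀ hθ.ne' h2
  obtain ⟨t, ht, h1⟩ := tA
  obtain ⟨s, hs, h2⟩ := tB
  have h3 := hA.nonneg hθ.ne' true hs
  have h4 := hB.nonneg hθ.ne' false ht
  have h5 := hsub (γ t) (γ s)
  have h6 := hsub z (γ t)
  linarith

theorem coord_true_sub_of_common_line (hθ : 0 < Real.sin θ) (hs : 0 < A.sinTo B)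
    (hσ : Real.sin θ * A.cosTo B + Real.cos θ * A.sinTo B = 0) {z w : ℂ}
    (hz : A.coord true z = 0) (hw : A.coord true w = 0) :
    B.coord true z - B.coord true w = A.coord false w - A.coord false z := by
  have h := A.coord_true_sub B hθ.ne' z w
  rw [hz, hw, sinTo_eq_of_common_line hθ hs hσ] at h
  apply mul_left_cancel₀ hθ.ne'
  rw [h]; ring

theorem interlaceCommonLine_of_lt (hA : A.Contains γ a b) (hB : B.Contains γ a b)
    (hθ : 0 < Real.sin θ) (hs : 0 < A.sinTo B)
    (hσ : Real.sin θ * A.cosTo B + Real.cos θ * A.sinTo B = 0)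
    (hc : ∀ z, B.coord false z = A.coord true z) {p q r s : ℝ} (hp : p ∈ Icc a b)
    (hs' : s ∈ Icc a b) (hpq : p < q) (hqr : q ≤ r) (hrs : r < s)
    (cp : A.coord true (γ p) = 0) (cs : A.coord true (γ s) = 0) (cq : A.coord false (γ q) = 0)
    (cr : B.coord true (γ r) = 0) (hle : A.coord false (γ p) ≤ A.coord false (γ s)) :
    A.InterlaceCommonLine B γ a b := by
  refine ⟨false, p, q, r, s, ?_, hqr, alternatesAt_of_coord hA hθ.ne' hp hs' hpq (hqr.trans_lt hrs)
    cp cq cs, alternatesAt_of_coord hB hθ.ne' hp hs' (hpq.trans_le hqr) hrs ?_ cr ?_, ?_, ?_⟩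
  · ext z
    rw [A.mem_line_iff hθ.ne', B.mem_line_iff hθ.ne']
    simp [hc]
  · simpa [hc] using cp
  · simpa [hc] using cs
  · exact A.wbtw_of_coord_le hθ.ne' false cp cs (hA.nonneg hθ.ne' _ hp) hle
  · refine (B.wbtw_of_coord_le hθ.ne' true ?_ ?_ (hB.nonneg hθ.ne' _ hs') ?_).symm
    · simpa [hc] using cs
    · simpa [hc] using cp
    · have := coord_true_sub_of_common_line hθ hs hσ cp cs
      linarith

theorem interlaceCommonLine {i j : Bool} {p₁ p₂ p₃ q₁ q₂ q₃ : ℝ}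
    (hp : A.IsForwardAt γ a b i p₁ p₂ p₃) (hq : B.IsBackwardAt γ a b j q₁ q₂ q₃)
    (hA : A.Contains γ a b) (hB : B.Contains γ a b) (hθ : 0 < Real.sin θ) (hγ : IsSimpleArc γ a b)
    (hs : 0 < A.sinTo B) (hσ : Real.sin θ * A.cosTo B + Real.cos θ * A.sinTo B = 0) :
    A.InterlaceCommonLine B γ a b := by
  have hc := coord_false_eq_coord_true hA hB hθ (hp.1.exists_coord_eq_zero hθ.ne' true)
    (hq.1.exists_coord_eq_zero hθ.ne' false) hs hσ
  have key := @interlaceCommonLine_of_lt θ γ a b A B hA hB hθ hs hσ hc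
  have hBf : ∀ t ∈ Icc a b, B.coord true (γ t) = 0 → p₂ ≤ t := fun t ht =>
    hp.le_of_first_ray hA hB hθ hγ hs ht
  have hAt : ∀ t ∈ Icc a b, A.coord false (γ t) = 0 → t ≤ q₂ := fun t ht =>
    hq.le_of_second_ray hA hB hθ hγ hs ht
  obtain ⟨-, k1, k2, -⟩ := id hp.1
  obtain ⟨-, k3, k4, -⟩ := id hq.1
  have a1 := hp.1.coord₁ hθ.ne'
  have a2 := hp.1.coord₂ hθ.ne'
  have a3 := hp.1.coord₃ hθ.ne'
  have b1 := hq.1.coord₁ hθ.ne'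
  have b2 := hq.1.coord₂ hθ.ne'
  have b3 := hq.1.coord₃ hθ.ne'
  have m1 := hp.1.mem₁
  have m2 := hp.1.mem₂
  have m3 := hp.1.mem₃
  have n1 := hq.1.mem₁
  have n2 := hq.1.mem₂
  have n3 := hq.1.mem₃
  have hp2 := hp.2
  have hq2 := hq.2
  -- The common line carries the first ray of `A` and the second of `B`. In each case the forward
  -- triple supplies `p < q` and the backward triple `r < s`, with `p`, `s` on that line and `q`,
  -- `r` on the other rays. A wrong order of `γ p` and `γ s` would give forbidden disjoint parts.
  cases i <;> cases j <;> simp only [Bool.not_false, Bool.not_true] at a1 a2 a3 b1 b2 b3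
  · have h1 := hBf _ n1 b1
    refine key m1 n2 k1 h1 k3 a1 (by rw [← hc, b2]) a2 b1 ?_
    by_contra! hlt
    exact hA.not_disjoint_of_coord_lt hθ.ne' hγ false n2 m1 m3 m2 (by simp [← hc, b2]) a1 a3 a2 hlt
      hp2 (disjoint_uIcc_of_max_lt_min' (by linarith) (by linarith) (by linarith) k2)
  · have h1 := hAt _ m2 a2
    refine key m1 n3 k1 h1 k4 a1 (by rw [← hc, b3]) a2 b2 ?_
    by_contra! hlt
    exact hA.not_disjoint_of_coord_lt hθ.ne' hγ false n3 m1 m3 m2 (by simp [← hc, b3]) a1 a3 a2 hlt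
      hp2 (disjoint_uIcc_of_max_lt_min' (by linarith) (by linarith) (by linarith) k2)
  · have h1 := hAt _ m3 a3
    have h2 := hBf _ n1 b1
    -- Here `p₃` and `q₁` are contacts with the outer, non-common rays. The bounds `hBf` and `hAt`
    -- do not compare them; disjoint parts with different support lines do.
    have h3 : p₃ ≤ q₁ := by
      by_contra! hlt
      exact hB.not_disjoint_of_precedes hA hθ hγ (i := false) (j := true) n3 n1 m3 m1 b3 b1 a3 a1
        (normal_true_ne_false hθ hs.le) hq2 hp2
        (disjoint_uIcc_of_max_lt_min' (by linarith) (by linarith) hlt (by linarith))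
    refine key m2 n2 k2 h3 k3 a2 (by rw [← hc, b2]) a3 b1 ?_
    by_contra! hlt
    refine hA.not_disjoint_of_precedes hA hθ hγ (i := false) (j := true) n2 m2 m3 m1
      (by simp [← hc, b2]) a2 a3 a1 (normal_true_ne_false hθ (by simp [sinTo, mul_comm])) hlt hp2
        (disjoint_uIcc_of_max_lt_min' (by linarith) (by linarith) (by linarith) (by linarith))
  · have h1 := hAt _ m3 a3
    refine key m2 n3 k2 h1 k4 a2 (by rw [← hc, b3]) a3 b2 ?_
    by_contra! hlt
    have e1 := coord_true_sub_of_common_line hθ hs hσ (z := γ p₂) (w := γ q₃) a2 (by rw [← hc, b3])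
    exact hB.not_disjoint_of_coord_lt hθ.ne' hγ true m2 n3 n1 n2 (by simp [hc, a2]) b3 b1 b2
      (by linarith) hq2
      (disjoint_uIcc_of_max_lt_min (by linarith) (by linarith) (by linarith) (by linarith))

/-- Each middle parameter precedes all contacts with the other angle's non-common ray. This is
contradictory at once unless both doubly touched rays lie on the common line. Then `p₂ = q₂`, and
the positions of `γ p₃` and `γ q₁` on that line give disjoint parts. -/
theorem not_isForwardAt_of_common_line {i j : Bool} {p₁ p₂ p₃ q₁ q₂ q₃ : ℝ}
    (hp : A.IsForwardAt γ a b i p₁ p₂ p₃)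
    (hA : A.Contains γ a b) (hB : B.Contains γ a b) (hθ : 0 < Real.sin θ) (hγ : IsSimpleArc γ a b)
    (hs : 0 < A.sinTo B) (hσ : Real.sin θ * A.cosTo B + Real.cos θ * A.sinTo B = 0) :
    ¬ B.IsForwardAt γ a b j q₁ q₂ q₃ := by
  intro hq
  have hc := coord_false_eq_coord_true hA hB hθ (hp.1.exists_coord_eq_zero hθ.ne' true)
    (hq.1.exists_coord_eq_zero hθ.ne' false) hs hσ
  have hBf : ∀ t ∈ Icc a b, B.coord true (γ t) = 0 → p₂ ≤ t := fun t ht =>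
    hp.le_of_first_ray hA hB hθ hγ hs ht
  have hAt : ∀ t ∈ Icc a b, A.coord false (γ t) = 0 → q₂ ≤ t := fun t ht =>
    hq.le_of_second_ray hA hB hθ hγ hs ht
  obtain ⟨-, k1, k2, -⟩ := id hp.1
  obtain ⟨-, k3, k4, -⟩ := id hq.1
  have a1 := hp.1.coord₁ hθ.ne'
  have a2 := hp.1.coord₂ hθ.ne'
  have a3 := hp.1.coord₃ hθ.ne'
  have b1 := hq.1.coord₁ hθ.ne'
  have b2 := hq.1.coord₂ hθ.ne'
  have b3 := hq.1.coord₃ hθ.ne'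
  have m1 := hp.1.mem₁
  have m2 := hp.1.mem₂
  have m3 := hp.1.mem₃
  have n1 := hq.1.mem₁
  have n2 := hq.1.mem₂
  have n3 := hq.1.mem₃
  have hp2 := hp.2
  have hq2 := hq.2
  cases i <;> cases j <;> simp only [Bool.not_false, Bool.not_true] at a1 a2 a3 b1 b2 b3
  · linarith [hBf _ n1 b1, hAt _ m2 a2]
  · have e : p₂ = q₂ := le_antisymm (hBf _ n2 b2) (hAt _ m2 a2)
    rw [hc] at b1 b3
    have e1 := coord_true_sub_of_common_line hθ hs hσ (z := γ q₃) (w := γ q₁) b3 b1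
    rcases lt_trichotomy (A.coord false (γ p₃)) (A.coord false (γ q₁)) with hlt | heq | hlt
    · exact hA.not_disjoint_of_coord_lt hθ.ne' hγ false m1 m3 n1 m2 a1 a3 b1 a2 hp2 hlt
        (disjoint_uIcc_of_max_lt_min (by linarith) (by linarith) (by linarith) (by linarith))
    · have := hγ.2 m3 n1 (A.ext_coord hθ.ne' false heq (a3.trans b1.symm))
      linarith
    · exact hA.not_disjoint_of_coord_lt hθ.ne' hγ false n3 n1 m3 m2 b3 b1 a3 a2 (by linarith) hlt
        (disjoint_uIcc_of_max_lt_min' (by linarith) (by linarith) (by linarith) (by linarith))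
  · linarith [hBf _ n1 b1, hAt _ m1 a1]
  · linarith [hBf _ n2 b2, hAt _ m1 a1]

end CommonLine

/-! ### Uniqueness of each kind, and interlacing -/

theorem not_isForwardAt_of_sinTo_nonneg {i j : Bool} {p₁ p₂ p₃ q₁ q₂ q₃ : ℝ}
    (hp : A.IsForwardAt γ a b i p₁ p₂ p₃)
    (hA : A.Contains γ a b) (hB : B.Contains γ a b) (hθ : 0 < Real.sin θ) (hγ : IsSimpleArc γ a b)
    (hne : A ≠ B) (hs : 0 ≤ A.sinTo B) : ¬ B.IsForwardAt γ a b j q₁ q₂ q₃ := by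
  intro hq
  rcases lt_or_ge (Real.sin θ * A.cosTo B + Real.cos θ * A.sinTo B) 0 with hσ | hσ
  · have h1 := hp.le_of_mem_right hA hB hθ hγ hs hσ hq.1.mem₁ (hq.1.coord₁ hθ.ne')
    have h2 := hq.le_of_mem_left hA hB hθ hγ hs hσ hp.1.mem₁ (hp.1.coord₁ hθ.ne')
    linarith [hp.1.2.1, hq.1.2.1]
  rcases hs.lt_or_eq with hs | hs
  · rcases hσ.lt_or_eq with hσ | hσ
    · exact hp.not_alternatesAt hA hB hθ hγ hs hσ hq.1
    · exact not_isForwardAt_of_common_line hp hA hB hθ hγ hs hσ.symm hq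
  · refine hne (eq_of_sinTo_eq_zero hA hB hθ (hp.1.exists_coord_eq_zero hθ.ne')
      (hq.1.exists_coord_eq_zero hθ.ne') hs.symm ?_)
    have := A.sinTo_sq_add_cosTo_sq B
    rw [← hs] at this hσ
    nlinarith

/-- Among the angles of a given size there is at most one alternating angle whose vertex is
behind. -/
theorem eq_of_isForwardAt {i j : Bool} {p₁ p₂ p₃ q₁ q₂ q₃ : ℝ}
    (hp : A.IsForwardAt γ a b i p₁ p₂ p₃) (hq : B.IsForwardAt γ a b j q₁ q₂ q₃)
    (hA : A.Contains γ a b) (hB : B.Contains γ a b) (hθ : 0 < Real.sin θ)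
    (hγ : IsSimpleArc γ a b) : A = B := by
  by_contra hne
  rcases le_total 0 (A.sinTo B) with hs | hs
  · exact not_isForwardAt_of_sinTo_nonneg hp hA hB hθ hγ hne hs hq
  · exact not_isForwardAt_of_sinTo_nonneg hq hB hA hθ hγ (Ne.symm hne)
      (by rw [sinTo_comm]; linarith) hp

theorem interlace_of_sinTo_nonneg {i j : Bool} {p₁ p₂ p₃ q₁ q₂ q₃ : ℝ}
    (hp : A.IsForwardAt γ a b i p₁ p₂ p₃) (hq : B.IsBackwardAt γ a b j q₁ q₂ q₃)
    (hA : A.Contains γ a b) (hB : B.Contains γ a b) (hθ : 0 < Real.sin θ) (hγ : IsSimpleArc γ a b)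
    (hne : A ≠ B) (hs : 0 ≤ A.sinTo B) : A.Interlace B γ a b := by
  rcases lt_or_ge (Real.sin θ * A.cosTo B + Real.cos θ * A.sinTo B) 0 with hσ | hσ
  · exact Or.inr (interlaceFourLines hp hq hA hB hθ hγ hs hσ)
  rcases hs.lt_or_eq with hs | hs
  · rcases hσ.lt_or_eq with hσ | hσ
    · exact absurd hq.1 (hp.not_alternatesAt hA hB hθ hγ hs hσ)
    · exact Or.inl (interlaceCommonLine hp hq hA hB hθ hγ hs hσ.symm)
  · refine absurd (eq_of_sinTo_eq_zero hA hB hθ (hp.1.exists_coord_eq_zero hθ.ne')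
      (hq.1.exists_coord_eq_zero hθ.ne') hs.symm ?_) hne
    have := A.sinTo_sq_add_cosTo_sq B
    rw [← hs] at this hσ
    nlinarith

theorem interlace_of_isForwardAt {i j : Bool} {p₁ p₂ p₃ q₁ q₂ q₃ : ℝ}
    (hp : A.IsForwardAt γ a b i p₁ p₂ p₃) (hq : B.IsBackwardAt γ a b j q₁ q₂ q₃)
    (hA : A.Contains γ a b) (hB : B.Contains γ a b) (hθ : 0 < Real.sin θ) (hγ : IsSimpleArc γ a b)
    (hne : A ≠ B) : A.Interlace B γ a b := by
  rcases le_total 0 (A.sinTo B) with hs | hs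
  · exact interlace_of_sinTo_nonneg hp hq hA hB hθ hγ hne hs
  · exact (interlace_of_sinTo_nonneg hq.reverse hp.reverse hB.reverse hA.reverse hθ hγ.reverse
      (Ne.symm hne) (by rw [sinTo_comm]; linarith)).of_reverse

theorem IsAlternating.exists_isForwardAt_or (h : A.IsAlternating γ a b) (hθ : Real.sin θ ≠ 0)
    (hγ : IsSimpleArc γ a b) : (∃ i p₁ p₂ p₃, A.IsForwardAt γ a b i p₁ p₂ p₃) ∨
      ∃ i p₁ p₂ p₃, A.IsBackwardAt γ a b i p₁ p₂ p₃ := by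
  obtain ⟨-, i, p₁, p₂, p₃, h⟩ := h
  exact (h.isForwardAt_or_isBackwardAt hθ hγ).imp (fun h => ⟨i, p₁, p₂, p₃, h⟩)
    fun h => ⟨i, p₁, p₂, p₃, h⟩

theorem encard_isAlternating_le_two (hθ : 0 < Real.sin θ) (hγ : IsSimpleArc γ a b) :
    {A : PlaneAngle θ | A.IsAlternating γ a b}.encard ≤ 2 := by
  set F := {A : PlaneAngle θ | A.Contains γ a b ∧ ∃ i p₁ p₂ p₃, A.IsForwardAt γ a b i p₁ p₂ p₃}
  set G := {A : PlaneAngle θ | A.Contains γ a b ∧ ∃ i p₁ p₂ p₃, A.IsBackwardAt γ a b i p₁ p₂ p₃}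
  have hF : F.encard ≤ 1 := encard_le_one_iff.2 fun A B ⟨hA, _, _, _, _, hp⟩ ⟨hB, _, _, _, _, hq⟩ =>
    eq_of_isForwardAt hp hq hA hB hθ hγ
  have hG : G.encard ≤ 1 := encard_le_one_iff.2 fun A B ⟨hA, _, _, _, _, hp⟩ ⟨hB, _, _, _, _, hq⟩ =>
    eq_of_isForwardAt hp.reverse hq.reverse hA.reverse hB.reverse hθ hγ.reverse
  calc _ ≤ (F ∪ G).encard := encard_le_encard fun A hA =>
        (hA.exists_isForwardAt_or hθ.ne' hγ).imp (fun h => ⟨hA.1, h⟩) fun h => ⟨hA.1, h⟩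
    _ ≤ F.encard + G.encard := encard_union_le _ _
    _ ≤ 1 + 1 := add_le_add hF hG
    _ = 2 := by norm_num

theorem interlace_or_interlace (hθ : 0 < Real.sin θ) (hγ : IsSimpleArc γ a b)
    (hA : A.IsAlternating γ a b) (hB : B.IsAlternating γ a b) (hne : A ≠ B) :
    A.Interlace B γ a b ∨ B.Interlace A γ a b := by
  rcases hA.exists_isForwardAt_or hθ.ne' hγ with ⟨_, _, _, _, hp⟩ | ⟨_, _, _, _, hp⟩ <;>
  rcases hB.exists_isForwardAt_or hθ.ne' hγ with ⟨_, _, _, _, hq⟩ | ⟨_, _, _, _, hq⟩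
  · exact absurd (eq_of_isForwardAt hp hq hA.1 hB.1 hθ hγ) hne
  · exact Or.inl (interlace_of_isForwardAt hp hq hA.1 hB.1 hθ hγ hne)
  · exact Or.inr (interlace_of_isForwardAt hq hp hB.1 hA.1 hθ hγ hne.symm)
  · exact absurd (eq_of_isForwardAt hp.reverse hq.reverse hA.1.reverse hB.1.reverse hθ
      hγ.reverse) hne

end PlaneAngle

/-! ### The convex hull of the arc -/

theorem exists_mem_Icc_of_partition (s : ℕ → ℝ) (k : ℕ) {t : ℝ} (h₀ : s 0 ≤ t) (ht : t < s k) :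
    ∃ i < k, t ∈ Icc (s i) (s (i + 1)) := by
  induction k with
  | zero => linarith
  | succ k ih =>
    rcases lt_or_ge t (s k) with h | h
    · obtain ⟨i, hi, hi'⟩ := ih h
      exact ⟨i, hi.trans (Nat.lt_succ_self k), hi'⟩
    · exact ⟨k, Nat.lt_succ_self k, h, ht.le⟩

/-- The hull is spanned by the finitely many break points. This is the only use of polygonality. -/
theorem IsSimplePolygonalArc.isCompact_convexHull {γ : ℝ → ℂ} {a b : ℝ}
    (h : IsSimplePolygonalArc γ a b) : IsCompact (convexHull ℝ (γ '' Icc a b)) := by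
  obtain ⟨k, s, hs0, hsk, hs⟩ := h.polygonal
  have hlo : ∀ i ≤ k, s 0 ≤ s i := fun i => by
    induction i with
    | zero => exact fun _ => le_rfl
    | succ i ih => exact fun hi => (ih (by omega)).trans (hs i (by omega)).1.le
  have hhi : ∀ i ≤ k, s (k - i) ≤ s k := fun i => by
    induction i with
    | zero => exact fun _ => le_rfl
    | succ i ih =>
      intro hi
      have h1 := (hs (k - (i + 1)) (by omega)).1.le
      rw [show k - (i + 1) + 1 = k - i by omega] at h1
      exact h1.trans (ih (by omega))
  have hmem : ∀ i ≤ k, s i ∈ Icc a b := fun i hi => by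
    have := hhi (k - i) (by omega)
    rw [show k - (k - i) = i by omega] at this
    exact ⟨hs0 ▸ hlo i hi, hsk ▸ this⟩
  set S : Set ℂ := (fun i => γ (s i)) '' (Iic k) with hS
  have hSfin : S.Finite := (finite_Iic k).image _
  have hsub : γ '' Icc a b ⊆ convexHull ℝ S := by
    rintro _ ⟨t, ht, rfl⟩
    rcases ht.2.lt_or_eq with h1 | h1
    · obtain ⟨i, hi, hti⟩ := exists_mem_Icc_of_partition s k (hs0 ▸ ht.1) (hsk ▸ h1)
      have h2 := mem_image_of_mem γ hti
      rw [(hs i hi).2] at h2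
      exact segment_subset_convexHull (mem_image_of_mem _ (mem_Iic.2 hi.le))
        (mem_image_of_mem _ (mem_Iic.2 hi)) h2
    · rw [h1, ← hsk]
      exact subset_convexHull ℝ S (mem_image_of_mem _ (mem_Iic.2 le_rfl))
  have heq : convexHull ℝ (γ '' Icc a b) = convexHull ℝ S := by
    apply Subset.antisymm (convexHull_min hsub (convex_convexHull ℝ S))
    apply convexHull_mono
    rintro _ ⟨i, hi, rfl⟩
    exact mem_image_of_mem γ (hmem i hi)
  rw [heq]
  exact hSfin.isCompact_convexHull ℝ

/-- Krein–Milman; the closure is superfluous because there are finitely many corners. -/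
theorem IsCornerList.convexHull_range {γ : ℝ → ℂ} {a b : ℝ} (h : IsSimplePolygonalArc γ a b)
    {n : ℕ} {X : Fin (n + 1) → ℂ} (hX : IsCornerList γ a b X) :
    convexHull ℝ (range X) = convexHull ℝ (γ '' Icc a b) := by
  have := closure_convexHull_extremePoints h.isCompact_convexHull (convex_convexHull ℝ _)
  rwa [← hX.1, ((finite_range X).isClosed_convexHull ℝ).closure_eq] at this

/-- Among the generators of a convex hull that minimise `f`, one has a value of `g` not smaller than
that of a given minimiser of `f` in the hull. -/
theorem exists_eq_and_le_of_mem_convexHull {ι : Type*} {X : ι → ℂ} {f g : ℂ → ℝ}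
    (hf : ∀ z w : ℂ, ∀ α β : ℝ, α + β = 1 → f (α • z + β • w) = α * f z + β * f w)
    (hg : ∀ z w : ℂ, ∀ α β : ℝ, α + β = 1 → g (α • z + β • w) = α * g z + β * g w)
    {z : ℂ} (hz : z ∈ convexHull ℝ (range X)) (hmin : ∀ i, f z ≤ f (X i)) :
    ∃ i, f (X i) = f z ∧ g z ≤ g (X i) := by
  by_contra! hcon
  -- If no generator qualifies, all of them lie in this lexicographic open half plane. It is convex
  -- and does not contain `z`.
  have hconv : Convex ℝ {w | f z < f w ∨ (f w = f z ∧ g w < g z)} := by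
    intro u hu v hv α β hα hβ hαβ
    rcases hα.eq_or_lt with rfl | hα
    · rw [zero_add] at hαβ; subst hαβ; simpa using hv
    rcases hβ.eq_or_lt with rfl | hβ
    · rw [add_zero] at hαβ; subst hαβ; simpa using hu
    simp only [mem_ofPred_eq] at *
    rw [hf _ _ _ _ hαβ, hg _ _ _ _ hαβ]
    have hβ' : β = 1 - α := by linarith
    subst hβ'
    rcases hu with hu | ⟨hu, hu'⟩ <;> rcases hv with hv | ⟨hv, hv'⟩
    · left; nlinarith
    · left; nlinarith
    · left; nlinarith
    · right; exact ⟨by rw [hu, hv]; ring, by nlinarith⟩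
  have hsub : range X ⊆ {w | f z < f w ∨ (f w = f z ∧ g w < g z)} := by
    rintro _ ⟨i, rfl⟩
    rcases (hmin i).lt_or_eq with h | h
    · exact Or.inl h
    · exact Or.inr ⟨h.symm, hcon i h.symm⟩
  rcases convexHull_min hsub hconv hz with h | ⟨-, h⟩ <;> exact lt_irrefl _ h

/-! ### Support lines and exposed corners -/

/-- The linear functional that is zero on the direction of argument `ψ` and grows to its left. -/
noncomputable def leftward (ψ : ℝ) (z : ℂ) : ℝ := Real.cos ψ * z.im - Real.sin ψ * z.re

theorem leftward_affine (ψ : ℝ) (z w : ℂ) (α β : ℝ) :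
    leftward ψ (α • z + β • w) = α * leftward ψ z + β * leftward ψ w := by
  simp [leftward]; ring

theorem continuous_leftward {T : Type*} [TopologicalSpace T] {f : T → ℝ} {g : T → ℂ}
    (hf : Continuous f) (hg : Continuous g) : Continuous fun p => leftward (f p) (g p) := by
  unfold leftward; fun_prop

/-- The line through `γ t` with the direction of argument `ψ` supports the arc from the right. -/
def IsSupportAt (γ : ℝ → ℂ) (a b ψ t : ℝ) : Prop :=
  t ∈ Icc a b ∧ ∀ s ∈ Icc a b, leftward ψ (γ t) ≤ leftward ψ (γ s)

theorem exists_isSupportAt {γ : ℝ → ℂ} {a b : ℝ} (hab : a ≤ b) (hγ : ContinuousOn γ (Icc a b))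
    (ψ : ℝ) : ∃ t, IsSupportAt γ a b ψ t := by
  have hc : ContinuousOn (fun t => leftward ψ (γ t)) (Icc a b) := by
    unfold leftward
    exact (continuousOn_const.mul (Complex.continuous_im.comp_continuousOn hγ)).sub
      (continuousOn_const.mul (Complex.continuous_re.comp_continuousOn hγ))
  obtain ⟨t, ht, hmin⟩ := isCompact_Icc.exists_isMinOn (nonempty_Icc.2 hab) hc
  exact ⟨t, ht, fun s hs => hmin hs⟩

theorem IsSupportAt.add_two_pi {γ : ℝ → ℂ} {a b ψ t : ℝ} (h : IsSupportAt γ a b ψ t) :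
    IsSupportAt γ a b (ψ + 2 * Real.pi) t := by
  simpa [IsSupportAt, leftward] using h

/-- The set is the projection to `φ` of a closed set of triples `(φ, t, u)`, along the compact
square of parameters. -/
theorem isClosed_setOf_isSupportAt {γ : ℝ → ℂ} {a b : ℝ} (hγ : ContinuousOn γ (Icc a b))
    {R : ℝ → ℝ → Prop} (hR : IsClosed {p : ℝ × ℝ | R p.1 p.2}) (δ : ℝ) :
    IsClosed {φ | ∃ t u, IsSupportAt γ a b φ t ∧ IsSupportAt γ a b (φ + δ) u ∧ R t u} := by
  have hg : Continuous (fun t : Icc a b => γ t) := continuousOn_iff_continuous_domRestrict.1 hγ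
  set Z : Set (ℝ × (Icc a b × Icc a b)) := {p | (∀ s : Icc a b,
    leftward p.1 (γ p.2.1) ≤ leftward p.1 (γ s) ∧
    leftward (p.1 + δ) (γ p.2.2) ≤ leftward (p.1 + δ) (γ s)) ∧ R p.2.1 p.2.2}
  have hZ : IsClosed Z := by
    refine IsClosed.inter (?_ : IsClosed {p | _}) (hR.preimage (by fun_prop :
      Continuous fun p : ℝ × (Icc a b × Icc a b) => ((p.2.1 : ℝ), (p.2.2 : ℝ))))
    simp only [ofPred_forall]
    have g1 : Continuous fun p : ℝ × (Icc a b × Icc a b) => γ p.2.1 :=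
      hg.comp (continuous_fst.comp continuous_snd)
    have g2 : Continuous fun p : ℝ × (Icc a b × Icc a b) => γ p.2.2 :=
      hg.comp (continuous_snd.comp continuous_snd)
    refine isClosed_iInter fun s => ?_
    have h1 : IsClosed {p : ℝ × (Icc a b × Icc a b) |
        leftward p.1 (γ p.2.1) ≤ leftward p.1 (γ s)} :=
      isClosed_le (continuous_leftward continuous_fst g1)
        (continuous_leftward continuous_fst continuous_const)
    have h2 : IsClosed {p : ℝ × (Icc a b × Icc a b) |
        leftward (p.1 + δ) (γ p.2.2) ≤ leftward (p.1 + δ) (γ s)} :=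
      isClosed_le (continuous_leftward (continuous_fst.add continuous_const) g2)
        (continuous_leftward (continuous_fst.add continuous_const) continuous_const)
    exact h1.inter h2
  convert isClosedMap_fst_of_compactSpace _ hZ
  ext φ
  constructor
  · rintro ⟨t, u, ht, hu, h⟩
    exact ⟨(φ, ⟨t, ht.1⟩, ⟨u, hu.1⟩), ⟨fun s => ⟨ht.2 s s.2, hu.2 s s.2⟩, h⟩, rfl⟩
  · rintro ⟨⟨φ', t, u⟩, ⟨h1, h2⟩, rfl⟩
    exact ⟨t, u, ⟨t.2, fun s hs => (h1 ⟨s, hs⟩).1⟩, ⟨u.2, fun s hs => (h1 ⟨s, hs⟩).2⟩, h2⟩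

/-- A corner point of the arc is exposed. -/
theorem IsCornerList.exists_leftward_lt {γ : ℝ → ℂ} {a b : ℝ} (h : IsSimplePolygonalArc γ a b)
    {n : ℕ} {X : Fin (n + 1) → ℂ} (hX : IsCornerList γ a b X) (j : Fin (n + 1)) :
    ∃ ψ, ∀ s ∈ Icc a b, γ s ≠ X j → leftward ψ (X j) < leftward ψ (γ s) := by
  have hK := hX.convexHull_range h
  have hext : X j ∈ (convexHull ℝ (range X)).extremePoints ℝ := by
    rw [hK, ← hX.1]; exact mem_range_self j
  have hnot : X j ∉ convexHull ℝ (range X \ {X j}) := fun hmem =>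
    (((convex_convexHull ℝ _).mem_extremePoints_iff_mem_sdiff_convexHull_sdiff).1 hext).2
      (convexHull_mono (sdiff_subset_sdiff_left (subset_convexHull ℝ _)) hmem)
  obtain ⟨f, u, hfu, hu⟩ := geometric_hahn_banach_point_closed (convex_convexHull ℝ _)
    (((finite_range X).sdiff).isClosed_convexHull ℝ) hnot
  have hlt : ∀ i, X i ≠ X j → f (X j) < f (X i) := fun i hi =>
    hfu.trans (hu _ (subset_convexHull ℝ _ ⟨mem_range_self i, hi⟩))
  have hfz : ∀ z : ℂ, f z = z.re * f 1 + z.im * f Complex.I := fun z => by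
    conv_lhs => rw [← Complex.re_add_im z]
    rw [map_add, ← mul_one ((z.re : ℂ)), ← Complex.real_smul, ← Complex.real_smul, map_smul,
      map_smul, smul_eq_mul, smul_eq_mul]
  -- `w` is the direction along which `f` is constant, oriented so that `f` grows to its left.
  set w : ℂ := ⟨f Complex.I, -f 1⟩ with hw
  have hleft : ∀ z, ‖w‖ * leftward w.arg z = f z := fun z => by
    have h1 := Complex.norm_mul_cos_arg w
    have h2 := Complex.norm_mul_sin_arg w
    rw [hfz, leftward, mul_sub, ← mul_assoc, ← mul_assoc, h1, h2]
    simp only [hw]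
    ring
  have hfaff : ∀ z w : ℂ, ∀ α β : ℝ, α + β = 1 → f (α • z + β • w) = α * f z + β * f w :=
    fun z w α β _ => by rw [map_add, map_smul, map_smul, smul_eq_mul, smul_eq_mul]
  have hstrict : ∀ s ∈ Icc a b, γ s ≠ X j → f (X j) < f (γ s) := by
    intro s hs hne
    by_contra! hle
    have hz : γ s ∈ convexHull ℝ (range X) := by
      rw [hK]; exact subset_convexHull ℝ _ (mem_image_of_mem γ hs)
    -- `X j` is the only corner value with `f ≤ f (γ s)`, so it bounds every functional `g` at `γ
    -- s`. Taking real and imaginary parts with both signs gives `γ s = X j`.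
    have key : ∀ g : ℂ →L[ℝ] ℝ, g (γ s) ≤ g (X j) := by
      intro g
      obtain ⟨i, h1, h2⟩ := exists_eq_and_le_of_mem_convexHull (f := f) (g := g) hfaff
        (fun z w α β _ => by rw [map_add, map_smul, map_smul, smul_eq_mul, smul_eq_mul]) hz
        (fun i => by
          by_cases hi : X i = X j
          · rw [hi]; exact hle
          · exact hle.trans (hlt i hi).le)
      have hi : X i = X j := by
        by_contra hi
        linarith [hlt i hi]
      rwa [hi] at h2
    apply hne
    apply Complex.ext
    · exact le_antisymm (key Complex.reCLM) (by simpa using key (-Complex.reCLM))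
    · exact le_antisymm (key Complex.imCLM) (by simpa using key (-Complex.imCLM))
  refine ⟨w.arg, fun s hs hne => ?_⟩
  have h1 := hstrict s hs hne
  rw [← hleft, ← hleft (γ s)] at h1
  exact lt_of_mul_lt_mul_left h1 (norm_nonneg w)

theorem IsCornerList.ne_zero {γ : ℝ → ℂ} {a b : ℝ} (h : IsSimplePolygonalArc γ a b)
    {n : ℕ} {X : Fin (n + 1) → ℂ} (hX : IsCornerList γ a b X) : n ≠ 0 := by
  rintro rfl
  have hK := hX.convexHull_range h
  have hr : range X = {X 0} := by
    ext z
    refine ⟨?_, fun hz => ⟨0, hz.symm⟩⟩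
    rintro ⟨i, rfl⟩
    exact congrArg X (Fin.ext (by simp))
  rw [hr, convexHull_singleton] at hK
  have hall : ∀ t ∈ Icc a b, γ t = X 0 := fun t ht => by
    have := subset_convexHull ℝ _ (mem_image_of_mem γ ht)
    rwa [← hK] at this
  have ha := left_mem_Icc.2 h.lt.le
  have hb := right_mem_Icc.2 h.lt.le
  exact h.lt.ne (h.injOn ha hb (by rw [hall a ha, hall b hb]))

/-! ### Existence: rotating an angle around the arc -/

namespace PlaneAngle

variable {θ : ℝ} {γ : ℝ → ℂ} {a b : ℝ}

theorem coord_affine (A : PlaneAngle θ) (i : Bool) (z w : ℂ) (α β : ℝ) (h : α + β = 1) :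
    A.coord i (α • z + β • w) = α * A.coord i z + β * A.coord i w := by
  obtain rfl : β = 1 - α := by linarith
  cases i <;> simp [coord] <;> ring

/-- For each direction `φ` of the first ray there is an angle of size `θ` that contains the arc and
both of whose rays are touched by it. -/
theorem exists_contains (hθ : 0 < Real.sin θ) (hab : a ≤ b) (hγ : ContinuousOn γ (Icc a b))
    (φ : ℝ) : ∃ A : PlaneAngle θ, A.Contains γ a b ∧
      (∀ t, IsSupportAt γ a b φ t → A.coord true (γ t) = 0) ∧
      (∀ t, IsSupportAt γ a b (φ + (θ + Real.pi)) t → A.coord false (γ t) = 0) ∧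
      ∀ ψ z w, Real.sin (φ - ψ) * (A.coord false z - A.coord false w) +
        Real.sin (φ + θ - ψ) * (A.coord true z - A.coord true w) = leftward ψ z - leftward ψ w := by
  obtain ⟨t₁, h₁⟩ := exists_isSupportAt hab hγ φ
  -- The second ray has direction `φ + θ` and the arc on its right. Adding `π` reverses its line, so
  -- that the arc is on the left as `IsSupportAt` demands.
  obtain ⟨t₂, h₂⟩ := exists_isSupportAt hab hγ (φ + (θ + Real.pi))
  have hneg : ∀ z, leftward (φ + (θ + Real.pi)) z = -leftward (φ + θ) z := fun z => by
    rw [← add_assoc]; simp only [leftward, Real.cos_add_pi, Real.sin_add_pi]; ring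
  -- Moving by `r` along the first support line from `γ t₁` leads to its intersection with the
  -- second one.
  set r : ℝ := (leftward (φ + θ) (γ t₁) - leftward (φ + θ) (γ t₂)) / Real.sin θ with hr
  have hr' : r * Real.sin θ = leftward (φ + θ) (γ t₁) - leftward (φ + θ) (γ t₂) := by
    rw [hr]; field_simp
  let A : PlaneAngle θ := ⟨γ t₁ + r * Complex.exp (φ * Complex.I), Complex.exp (φ * Complex.I),
    Complex.norm_exp_ofReal_mul_I φ⟩
  have hdr : A.dir.re = Real.cos φ := Complex.exp_ofReal_mul_I_re φ
  have hdi : A.dir.im = Real.sin φ := Complex.exp_ofReal_mul_I_im φ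
  have hvr : A.vertex.re = (γ t₁).re + r * Real.cos φ := by
    simp [A, Complex.exp_ofReal_mul_I_re, Complex.exp_ofReal_mul_I_im]
  have hvi : A.vertex.im = (γ t₁).im + r * Real.sin φ := by
    simp [A, Complex.exp_ofReal_mul_I_re, Complex.exp_ofReal_mul_I_im]
  have hsq := Real.sin_sq_add_cos_sq φ
  have htrue : ∀ z, A.coord true z = (leftward φ z - leftward φ (γ t₁)) / Real.sin θ := fun z => by
    simp only [coord, hdr, hdi, hvr, hvi, leftward]
    congr 1
    ring
  have hfalse : ∀ z, A.coord false z =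
      (leftward (φ + θ) (γ t₂) - leftward (φ + θ) z) / Real.sin θ := fun z => by
    have : leftward (φ + θ) (γ t₂) = leftward (φ + θ) (γ t₁) - r * Real.sin θ := by rw [hr']; ring
    simp only [coord, rayDir_re_true, rayDir_im_true, hdr, hdi, hvr, hvi, this]
    congr 1
    simp only [leftward, Real.cos_add, Real.sin_add]
    linear_combination (-r * Real.sin θ) * hsq
  refine ⟨A, ?_, fun t ht => ?_, fun t ht => ?_, fun ψ z w => ?_⟩
  · rintro _ ⟨t, ht, rfl⟩
    rw [A.mem_region_iff hθ.ne']
    rintro (_ | _)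
    · rw [hfalse]
      have := h₂.2 t ht
      rw [hneg, hneg] at this
      exact div_nonneg (by linarith) hθ.le
    · rw [htrue]
      exact div_nonneg (sub_nonneg.2 (h₁.2 t ht)) hθ.le
  · rw [htrue, le_antisymm (h₁.2 t ht.1) (ht.2 t₁ h₁.1), sub_self, zero_div]
  · have := le_antisymm (h₂.2 t ht.1) (ht.2 t₂ h₂.1)
    rw [hneg, hneg, neg_inj] at this
    rw [hfalse, this, sub_self, zero_div]
  · rw [hfalse, hfalse, htrue, htrue]
    field_simp
    simp only [leftward]
    rw [show φ + θ - ψ = (φ + θ) - ψ by ring]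
    have e1 : Real.sin (φ + θ - ψ) * Real.cos φ - Real.sin (φ - ψ) * Real.cos (φ + θ) =
        Real.sin θ * Real.cos ψ := by
      simp only [Real.sin_sub, Real.cos_add, Real.sin_add]
      linear_combination Real.sin θ * Real.cos ψ * hsq
    have e2 : Real.sin (φ + θ - ψ) * Real.sin φ - Real.sin (φ - ψ) * Real.sin (φ + θ) =
        Real.sin θ * Real.sin ψ := by
      simp only [Real.sin_sub, Real.cos_add, Real.sin_add]
      linear_combination Real.sin θ * Real.sin ψ * hsq
    linear_combination (z.im - w.im) * e1 - (z.re - w.re) * e2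

/-- The point `γ t₀` is the only point of the arc where a certain support line touches that
separates the arc from the vertex of `A`. -/
def FacesVertex (A : PlaneAngle θ) (γ : ℝ → ℂ) (a b t₀ : ℝ) : Prop :=
  ∃ m n : ℝ, 0 ≤ m ∧ 0 ≤ n ∧ ∀ s ∈ Icc a b, s ≠ t₀ →
    m * A.coord false (γ t₀) + n * A.coord true (γ t₀) <
      m * A.coord false (γ s) + n * A.coord true (γ s)

theorem FacesVertex.reverse {A : PlaneAngle θ} {t₀ : ℝ} (h : A.FacesVertex γ a b t₀) :
    A.FacesVertex (fun t => γ (-t)) (-b) (-a) (-t₀) := by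
  obtain ⟨m, n, hm, hn, h⟩ := h
  refine ⟨m, n, hm, hn, fun s hs hne => ?_⟩
  simp only [neg_neg]
  exact h _ (neg_mem_Icc_neg hs) fun h' => hne (by rw [← h', neg_neg])

theorem FacesVertex.eq_of_coord_eq_zero {A : PlaneAngle θ} {t₀ t : ℝ}
    (h : A.FacesVertex γ a b t₀) (hA : A.Contains γ a b) (hθ : Real.sin θ ≠ 0)
    (ht₀ : t₀ ∈ Icc a b) (ht : t ∈ Icc a b) (hc : ∀ i, A.coord i (γ t) = 0) : t = t₀ := by
  obtain ⟨m, n, hm, hn, h⟩ := h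
  by_contra hne
  have h1 := h t ht hne
  rw [hc, hc] at h1
  linarith [mul_nonneg hm (hA.nonneg hθ false ht₀), mul_nonneg hn (hA.nonneg hθ true ht₀)]

theorem eq_vertex_of_coord_eq_zero (A : PlaneAngle θ) (hθ : Real.sin θ ≠ 0) {z : ℂ}
    (hc : ∀ i, A.coord i z = 0) : z = A.vertex := by
  rw [A.eq_vertex_add_coord hθ false z, hc, hc]; simp

/-- If a corner is passed before (or after) a point of each face of the convex hull, then it faces
the vertex of an angle of size `θ` around the arc which has its vertex there or is alternating. -/
theorem exists_facesVertex (hθ₀ : 0 < θ) (hθπ : θ < Real.pi) (hab : a ≤ b)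
    (hγ : ContinuousOn γ (Icc a b)) {t₀ ψ : ℝ} (ht₀ : t₀ ∈ Icc a b)
    (hψ : ∀ s ∈ Icc a b, s ≠ t₀ → leftward ψ (γ t₀) < leftward ψ (γ s))
    (hfirst : ∀ φ, ∃ t, IsSupportAt γ a b φ t ∧ t₀ ≤ t) :
    ∃ A : PlaneAngle θ, A.Contains γ a b ∧ (A.vertex = γ t₀ ∨ A.IsAlternating γ a b) ∧
      A.FacesVertex γ a b t₀ := by
  have hθ : 0 < Real.sin θ := Real.sin_pos_of_pos_of_lt_pi hθ₀ hθπ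
  have hs0 : IsSupportAt γ a b ψ t₀ := ⟨ht₀, fun s hs => by
    rcases eq_or_ne s t₀ with rfl | hne
    · exact le_rfl
    · exact (hψ s hs hne).le⟩
  have c1 := isClosed_setOf_isSupportAt hγ (R := fun t u => t ≤ u)
    (isClosed_le continuous_fst continuous_snd) (θ + Real.pi)
  have c2 := isClosed_setOf_isSupportAt hγ (R := fun t u => u ≤ t)
    (isClosed_le continuous_snd continuous_fst) (θ + Real.pi)
  -- One closed set has a contact with the first ray no later than one with the second, the other
  -- the reverse. At `φ = ψ` the first ray touches at `t₀`, and at `φ = ψ + (π - θ)` the second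
  -- does; by `hfirst` each set is met, and connectedness gives a common `φ`.
  obtain ⟨φ, ⟨hφ1, hφ2⟩, ⟨x₁, x₂, hx₁, hx₂, hx⟩, ⟨y₁, y₂, hy₁, hy₂, hy⟩⟩ :=
    isPreconnected_closed_iff.1 (isPreconnected_Icc (a := ψ) (b := ψ + (Real.pi - θ))) _ _ c1 c2
      (fun φ _ => by
        obtain ⟨t, ht⟩ := exists_isSupportAt hab hγ φ
        obtain ⟨u, hu⟩ := exists_isSupportAt hab hγ (φ + (θ + Real.pi))
        exact (le_total t u).imp (fun h => ⟨t, u, ht, hu, h⟩) fun h => ⟨t, u, ht, hu, h⟩)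
      (by
        obtain ⟨u, hu, hle⟩ := hfirst (ψ + (θ + Real.pi))
        exact ⟨ψ, left_mem_Icc.2 (by linarith), t₀, u, hs0, hu, hle⟩)
      (by
        obtain ⟨u, hu, hle⟩ := hfirst (ψ + (Real.pi - θ))
        refine ⟨ψ + (Real.pi - θ), right_mem_Icc.2 (by linarith), u, t₀, hu, ?_, hle⟩
        rw [show ψ + (Real.pi - θ) + (θ + Real.pi) = ψ + 2 * Real.pi by ring]
        exact hs0.add_two_pi)
  obtain ⟨A, hA, hf, hg, hlin⟩ := exists_contains hθ hab hγ φ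
  have hF : A.FacesVertex γ a b t₀ := by
    -- These are the coefficients of `leftward ψ` in the coordinates of `A`; they are nonnegative
    -- because `ψ ≤ φ ≤ ψ + (π - θ)`.
    refine ⟨Real.sin (φ - ψ), Real.sin (φ + θ - ψ),
      Real.sin_nonneg_of_nonneg_of_le_pi (by linarith) (by linarith),
      Real.sin_nonneg_of_nonneg_of_le_pi (by linarith) (by linarith), fun s hs hne => ?_⟩
    have h1 := hlin ψ (γ s) (γ t₀)
    have h2 := hψ s hs hne
    linarith
  refine ⟨A, hA, ?_, hF⟩
  by_cases hv : ∃ t ∈ Icc a b, ∀ i, A.coord i (γ t) = 0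
  · obtain ⟨t, ht, hc⟩ := hv
    left
    rw [← A.eq_vertex_of_coord_eq_zero hθ.ne' hc, hF.eq_of_coord_eq_zero hA hθ.ne' ht₀ ht hc]
  · right
    have hne : ∀ t u, A.coord true (γ t) = 0 → A.coord false (γ u) = 0 → t ∈ Icc a b → t ≠ u := by
      rintro t _ h1 h2 ht rfl
      exact hv ⟨t, ht, fun i => by cases i <;> assumption⟩
    have e1 := hf x₁ hx₁
    have e2 := hg x₂ hx₂
    have e3 := hf y₁ hy₁
    have e4 := hg y₂ hy₂
    have hx' := lt_of_le_of_ne hx (hne _ _ e1 e2 hx₁.1)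
    have hy' := lt_of_le_of_ne hy (hne _ _ e3 e4 hy₁.1).symm
    refine ⟨hA, ?_⟩
    -- Off the vertex, `x₁ < x₂` and `y₂ < y₁` are contacts in the orders first–second and
    -- second–first. Either `x₁ < y₂ < y₁` or `y₂ < x₁ < x₂` alternates.
    rcases lt_or_ge x₁ y₂ with h | h
    · exact ⟨false, x₁, y₂, y₁, alternatesAt_of_coord hA hθ.ne' hx₁.1 hy₁.1 h hy' e1 e4 e3⟩
    · have h' := lt_of_le_of_ne h (hne _ _ e1 e4 hx₁.1).symm
      exact ⟨true, y₂, x₁, x₂, alternatesAt_of_coord hA hθ.ne' hy₂.1 hx₂.1 h' hx' e4 e1 e2⟩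

/-- If the vertex of `A` is behind, then the last corner of the arc does not face it. -/
theorem IsForwardAt.not_facesVertex {A : PlaneAngle θ} {i : Bool} {p₁ p₂ p₃ t₀ : ℝ}
    (h : A.IsForwardAt γ a b i p₁ p₂ p₃) (hθ : Real.sin θ ≠ 0) (hγ : IsSimpleArc γ a b)
    (hA : A.Contains γ a b) (ht₀ : t₀ ∈ Icc a b)
    (hcorner : ∃ e ∈ Icc a b, e ≤ t₀ ∧ A.coord (!i) (γ e) = 0 ∧
      A.coord i (γ p₃) ≤ A.coord i (γ e)) : ¬ A.FacesVertex γ a b t₀ := by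
  rintro ⟨m, n, hm, hn, hmn⟩
  have h1 := h.1.coord₁ hθ
  have h2 := h.1.coord₂ hθ
  have h3 := h.1.coord₃ hθ
  -- `le_of_near` needs both coefficients positive. If one vanishes, the functional is 0 at a
  -- contact, which must be `t₀` by uniqueness: this is `p₂`, or else `p₁` and `p₃` would coincide.
  have hle : t₀ ≤ p₂ := by
    have hz : ∀ t ∈ Icc a b, m * A.coord false (γ t) + n * A.coord true (γ t) = 0 → t = t₀ := by
      intro t ht h0
      by_contra hne
      have := hmn t ht hne
      linarith [mul_nonneg hm (hA.nonneg hθ false ht₀), mul_nonneg hn (hA.nonneg hθ true ht₀)]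
    have hlt : p₁ ≠ p₃ := (h.1.2.1.trans h.1.2.2.1).ne
    rcases hm.lt_or_eq with hm' | hm'
    · rcases hn.lt_or_eq with hn' | hn'
      · refine h.le_of_near hθ hγ hA hm' hn' ht₀ fun s hs => ?_
        rcases eq_or_ne s t₀ with rfl | hne
        · simp
        · linarith [hmn s hs hne]
      · cases i
        · exact (hz _ h.1.mem₂ (by rw [h2, ← hn']; ring)).ge
        · exact absurd ((hz _ h.1.mem₁ (by simp only [Bool.not_true] at h1; rw [h1, ← hn']; ring)).trans
            (hz _ h.1.mem₃ (by simp only [Bool.not_true] at h3; rw [h3, ← hn']; ring)).symm) hlt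
    · cases i
      · exact absurd ((hz _ h.1.mem₁ (by simp only [Bool.not_false] at h1; rw [h1, ← hm']; ring)).trans
          (hz _ h.1.mem₃ (by simp only [Bool.not_false] at h3; rw [h3, ← hm']; ring)).symm) hlt
      · exact (hz _ h.1.mem₂ (by rw [h2, ← hm']; ring)).ge
  obtain ⟨e, he, het, hce, hge⟩ := hcorner
  have hlt := h.2
  have k1 := h.1.2.1
  have k2 := h.1.2.2.1
  have hlt2 : A.coord i (γ p₃) < A.coord i (γ e) := by
    refine lt_of_le_of_ne hge fun heq => ?_
    have := hγ.2 h.1.mem₃ he (A.ext_coord hθ i heq (by rw [h3, hce]))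
    linarith
  have hep : e < p₂ := by
    refine lt_of_le_of_ne (het.trans hle) fun heq => ?_
    rw [heq, h2] at hlt2
    linarith [hA.nonneg hθ i h.1.mem₃]
  -- On ray `i` the order is `p₁, p₃, e`, but `p₁` and `e` both precede `p₂`, while `p₃` follows it.
  exact hA.not_disjoint_of_coord_lt hθ hγ i h.1.mem₁ h.1.mem₃ he h.1.mem₂ h1 h3 hce h2 hlt hlt2
    (disjoint_uIcc_of_max_lt_min (by linarith) k1 (by linarith) hep)

theorem exists_contains_ne (hθ₀ : 0 < θ) (hθπ : θ < Real.pi) (hγ : IsSimplePolygonalArc γ a b)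
    {n : ℕ} {X : Fin (n + 1) → ℂ} (hX : IsCornerList γ a b X) :
    ∃ A B : PlaneAngle θ, A ≠ B ∧ A.Contains γ a b ∧ B.Contains γ a b ∧
      (A.vertex = X 0 ∨ A.IsAlternating γ a b) ∧
      (B.vertex = X (Fin.last n) ∨ B.IsAlternating γ a b) := by
  have hθ : 0 < Real.sin θ := Real.sin_pos_of_pos_of_lt_pi hθ₀ hθπ
  have hγs : IsSimpleArc γ a b := ⟨hγ.continuousOn, hγ.injOn⟩
  have hn := hX.ne_zero hγ
  have hK := hX.convexHull_range hγ
  obtain ⟨t, hmono, ht⟩ := id hX.2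
  have hmem : ∀ s ∈ Icc a b, γ s ∈ convexHull ℝ (range X) := fun s hs => by
    rw [hK]; exact subset_convexHull ℝ _ (mem_image_of_mem γ hs)
  have hexp : ∀ j, ∃ ψ, ∀ s ∈ Icc a b, s ≠ t j → leftward ψ (γ (t j)) < leftward ψ (γ s) := by
    intro j
    obtain ⟨ψ, hψ⟩ := hX.exists_leftward_lt hγ j
    refine ⟨ψ, fun s hs hne => ?_⟩
    rw [(ht j).2]
    exact hψ s hs fun h => hne (hγ.injOn hs (ht j).1 (by rw [h, (ht j).2]))
  have hsupp : ∀ φ, ∃ j, IsSupportAt γ a b φ (t j) := by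
    intro φ
    obtain ⟨u, hu, hmin⟩ := exists_isSupportAt hγ.lt.le hγ.continuousOn φ
    obtain ⟨j, hj, -⟩ := exists_eq_and_le_of_mem_convexHull (f := leftward φ) (g := leftward φ)
      (fun z w α β _ => leftward_affine φ z w α β) (fun z w α β _ => leftward_affine φ z w α β)
      (hmem u hu) (fun i => by rw [← (ht i).2]; exact hmin _ (ht i).1)
    exact ⟨j, (ht j).1, fun s hs => by rw [(ht j).2, hj]; exact hmin s hs⟩
  have hcorner : ∀ (A : PlaneAngle θ), A.Contains γ a b → ∀ i, ∀ u ∈ Icc a b,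
      A.coord (!i) (γ u) = 0 → ∃ j, A.coord (!i) (γ (t j)) = 0 ∧
        A.coord i (γ u) ≤ A.coord i (γ (t j)) := by
    intro A hA i u hu h0
    obtain ⟨j, hj, hle⟩ := exists_eq_and_le_of_mem_convexHull (f := A.coord (!i))
      (g := A.coord i) (A.coord_affine _) (A.coord_affine _) (hmem u hu)
      (fun k => by rw [h0, ← (ht k).2]; exact hA.nonneg hθ.ne' _ (ht k).1)
    exact ⟨j, by rw [(ht j).2, hj, h0], by rw [(ht j).2]; exact hle⟩
  obtain ⟨ψ₀, hψ₀⟩ := hexp 0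
  obtain ⟨ψ₁, hψ₁⟩ := hexp (Fin.last n)
  obtain ⟨A, hA, hA', fA⟩ := exists_facesVertex hθ₀ hθπ hγ.lt.le hγ.continuousOn (ht 0).1 hψ₀
    (fun φ => by
      obtain ⟨j, hj⟩ := hsupp φ
      exact ⟨t j, hj, hmono.monotone (Fin.zero_le j)⟩)
  obtain ⟨B, hB, hB', fB⟩ := exists_facesVertex (γ := fun t => γ (-t)) (a := -b) (b := -a)
    (t₀ := -t (Fin.last n)) (ψ := ψ₁) hθ₀ hθπ
    (neg_le_neg hγ.lt.le) hγs.reverse.1 (neg_mem_Icc (ht _).1)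
    (fun s hs hne => by
      rw [neg_neg]
      exact hψ₁ _ (neg_mem_Icc_neg hs) fun h => hne (by rw [← h, neg_neg]))
    (fun φ => by
      obtain ⟨j, hj, hj'⟩ := hsupp φ
      refine ⟨-t j, ⟨neg_mem_Icc hj, fun s hs => ?_⟩, neg_le_neg (hmono.monotone (Fin.le_last j))⟩
      simp only [neg_neg]
      exact hj' _ (neg_mem_Icc_neg hs))
  have hB : B.Contains γ a b := by simpa only [neg_neg] using hB.reverse
  have fB : B.FacesVertex γ a b (t (Fin.last n)) := by simpa only [neg_neg] using fB.reverse
  have hB' : B.vertex = γ (t (Fin.last n)) ∨ B.IsAlternating γ a b := by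
    rw [neg_neg] at hB'
    refine hB'.imp_right ?_
    rintro ⟨-, i, p, q, r, h⟩
    exact ⟨hB, i, _, _, _, by simpa only [neg_neg] using h.reverse⟩
  have hlt : t 0 < t (Fin.last n) := hmono (Fin.pos_iff_ne_zero.2 (by
    rw [Ne, Fin.ext_iff]; simpa using hn))
  refine ⟨A, B, ?_, hA, hB, by rwa [← (ht 0).2], by rwa [← (ht _).2]⟩
  rintro rfl
  -- If the two angles coincide, an arc point at the vertex would be the first and the last corner
  -- at once, so the angle is alternating.
  have hvert : ∀ u ∈ Icc a b, A.vertex ≠ γ u := by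
    intro u hu hv
    have hc : ∀ i, A.coord i (γ u) = 0 := fun i => by
      rw [← hv]; simpa using A.coord_vertex_add hθ.ne' 0 0 i
    have e1 := fA.eq_of_coord_eq_zero hA hθ.ne' (ht _).1 hu hc
    have e2 := fB.eq_of_coord_eq_zero hA hθ.ne' (ht _).1 hu hc
    exact hlt.ne (e1.symm.trans e2)
  have halt := hA'.resolve_left (hvert _ (ht _).1)
  rcases halt.exists_isForwardAt_or hθ.ne' hγs with ⟨i, p₁, p₂, p₃, hp⟩ | ⟨i, p₁, p₂, p₃, hp⟩
  · obtain ⟨j, h0, hle⟩ := hcorner A hA i p₃ hp.1.mem₃ (hp.1.coord₃ hθ.ne')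
    exact hp.not_facesVertex hθ.ne' hγs hA (ht _).1
      ⟨t j, (ht j).1, hmono.monotone (Fin.le_last j), h0, hle⟩ fB
  · obtain ⟨j, h0, hle⟩ := hcorner A hA i p₁ hp.1.mem₁ (hp.1.coord₁ hθ.ne')
    refine hp.reverse.not_facesVertex hθ.ne' hγs.reverse hA.reverse (neg_mem_Icc (ht 0).1)
      ⟨-t j, neg_mem_Icc (ht j).1, neg_le_neg (hmono.monotone (Fin.zero_le j)), ?_, ?_⟩ fA.reverse
    · rwa [neg_neg]
    · rwa [neg_neg, neg_neg]

end PlaneAngle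

theorem lemma1 (θ : ℝ) (hθ₀ : 0 < θ) (hθπ : θ < Real.pi)
    (γ : ℝ → ℂ) (a b : ℝ) (hγ : IsSimplePolygonalArc γ a b)
    (n : ℕ) (X : Fin (n + 1) → ℂ) (hX : IsCornerList γ a b X) :
    (∃ A B : PlaneAngle θ, A ≠ B ∧ A.Contains γ a b ∧ B.Contains γ a b ∧
      (A.vertex = X 0 ∨ A.IsAlternating γ a b) ∧
      (B.vertex = X (Fin.last n) ∨ B.IsAlternating γ a b)) ∧
    {A : PlaneAngle θ | A.IsAlternating γ a b}.encard ≤ 2 ∧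
    (∀ A B : PlaneAngle θ, A.IsAlternating γ a b → B.IsAlternating γ a b → A ≠ B →
      A.Interlace B γ a b ∨ B.Interlace A γ a b) := by
  have hθ : 0 < Real.sin θ := Real.sin_pos_of_pos_of_lt_pi hθ₀ hθπ
  have hγs : IsSimpleArc γ a b := ⟨hγ.continuousOn, hγ.injOn⟩
  exact ⟨PlaneAngle.exists_contains_ne hθ₀ hθπ hγ hX, PlaneAngle.encard_isAlternating_le_two hθ hγs,
    fun _ _ hA hB hne => PlaneAngle.interlace_or_interlace hθ hγs hA hB hne⟩
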